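/- **Setting.** Let $u_1,\dots,u_s\in\mathbb{R}[m,\sigma]$, one of which is $R^2-m^2-\sigma^2$ for some $R\in\mathbb{R}$, and let $S=\{(m,\sigma): u_j(m,\sigma)\ge 0,\ j=1,\dots,s\}$ (a compact set); assume $S\subset\mathbb{R}\times\mathbb{R}_+$. Let $v=n_0=\max_j d_j$ with $d_j=\lceil \deg(u_j)/2\rceil$. Let $\mu$ be a Borel probability measure on $\mathbb{R}$ with finite moments $\mu_j=\int x^j\,d\mu$, $j\in\mathbb{N}$. Write $\mathcal{N}(m,\sigma)$ for the Gaussian measure on $\mathbb{R}$ with mean $m$ and standard deviation $\sigma$ (the Dirac measure $\delta_m$ if $\sigma=0$), and $$p_j(m,\sigma)=\sum_{0\le 2k\le j}\binom{j}{2k}(2k-1)!!\,\sigma^{2k}m^{j-2k}\qquad((-1)!!=1)$$ for the polynomial giving its $j$-th moment. Let $\mathcal{P}(S)$ be the set of Borel probability measures on $S$; for $\phi\in\mathcal{P}(S)$ let $\nu_\phi=\int_S\mathcal{N}(m,\sigma)\,d\phi(m,\sigma)$. The measure $\mu$ is a *mixture of Gaussian measures with parameters in $S$* if $\mu=\nu_\phi$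 for some $\phi\in\mathcal{P}(S)$, which is then called a mixing measure. A measure is *$r$-atomic* if it is a combination, with positive weights, of the Dirac measures at $r$ distinct points. Let $$\tau=\inf_{\phi\in\mathcal{P}(S),\,\lambda\in\mathcal{P}(\mathbb{R}^2)}\Big\{\int (x-y)^2\,d\lambda(x,y):\ \lambda_x=\mu,\ \lambda_y=\nu_\phi\Big\},\tag{1}$$ where $\lambda_x,\lambda_y$ are the marginals of $\lambda$. For a real sequence $\boldsymbol{y}=(y_{(i,j)})$ let $y(\sum p_{ij}x^iy^j)=\sum p_{ij}\,y_{(i,j)}$, let $\mathbf{M}_n(\boldsymbol{y})$ be the moment matrix with entries $y_{(i+i',j+j')}$, $i+j\le n$, $i'+j'\le n$, and let $\mathbf{M}_n(u\cdot\boldsymbol{y})$ be the localizing matrix, i.e. the moment matrix of the sequence $(u\cdot\boldsymbol y)_{(i,j)}=\sum_{k,\ell} u_{k\ell}\,y_{(i+k,j+\ell)}$. For $n\ge n_0$ let $$\tau_n=\inf_{\boldsymbol\phi,\boldsymbol\lambda}\Big\{\lambda((x-y)^2):\ \lambda_{(j,0)}=\mu_j,\ \lambda_{(0,j)}=\phi(p_j)\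 \ \forall j\le 2n;\ \mathbf{M}_n(\boldsymbol\lambda)\succeq0,\ \mathbf{M}_n(\boldsymbol\phi)\succeq0,\ \mathbf{M}_{n-d_j}(u_j\cdot\boldsymbol\phi)\succeq0\ \ \forall j\Big\},\tag{2}$$ over vectors $\boldsymbol\phi=(\phi_{(i,j)})_{i+j\le 2n}$ and $\boldsymbol\lambda=(\lambda_{(i,j)})_{i+j\le 2n}$. Finally, let $\lambda_\mu\in\mathcal{P}(\mathbb{R}^2)$ be the diagonal coupling of $\mu$ with itself, that is, the image of $\mu$ under $x\mapsto(x,x)$. **Theorem.** (i) $\mu$ is a mixture of Gaussian measures, all with parameters $(m,\sigma)\in S$, if and only if $(\lambda_\mu,\phi^*)$ is an optimal solution of (1) for some $\phi^*\in\mathcal{P}(S)$. In that case $\tau=0$ and $\tau_n=0$ for all $n\ge n_0$. If moreover $\mu$ is such a mixture with an $r$-atomic mixing measure $\phi^*\in\mathcal{P}(S)$, then for every sufficiently large $n$ the vectors $(\boldsymbol\lambda^*,\boldsymbol\phi^*)$ of moments of degree at most $2n$ of $\lambda_\mu$ and $\phi^*$ form an optimal solution of (2), and $$\mathrm{rank}\,\mathbf{M}_n(\boldsymbol\phi^*)=\mathrm{rank}\,\mathbf{M}_{n-v}(\boldsymbol\phi^*)=r.\tag{3}$$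 (ii) Conversely, let $n\ge n_0$, let $(\boldsymbol\lambda^*,\boldsymbol\phi^*)$ be an optimal solution of (2) with $\tau_n=0$, and suppose that (3) holds. Then $\boldsymbol\phi^*$ is the vector of moments of degree at most $2n$ of some $r$-atomic probability measure on $S$. Moreover, for any such measure $\phi^*$, one has $\mu=\nu_{\phi^*}$ if and only if $$\mu_j=\int p_j(m,\sigma)\,d\phi^*(m,\sigma)\qquad\forall j>n+1.$$ -/

import Mathlib

open MeasureTheory ProbabilityTheory
open scoped NNReal ENNReal

noncomputable section

namespace GaussMix

/-! ### Gaussian mixtures -/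

/-- The family of Gaussian laws `(m, σ) ↦ N(m, σ)` on `ℝ`, with mean `m` and standard deviation `σ`
(variance `σ ^ 2`); for `σ = 0` it is the Dirac mass at `m`. -/
def gaussianKernel : Kernel (ℝ × ℝ) ℝ where
  toFun p := gaussianReal p.1 (NNReal.mk (p.2 ^ 2) (sq_nonneg p.2))
  measurable' := by
    have key : ∀ p : ℝ × ℝ, gaussianReal p.1 (NNReal.mk (p.2 ^ 2) (sq_nonneg p.2)) =
        (gaussianReal 0 1).map (fun z : ℝ => p.1 + p.2 * z) := by
      intro p
      have h1 := gaussianReal_map_const_mul (μ := 0) (v := 1) p.2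
      have h2 := gaussianReal_map_const_add (μ := p.2 * 0) (v := NNReal.mk (p.2 ^ 2) (sq_nonneg p.2) * 1) p.1
      rw [← h1, Measure.map_map (by fun_prop) (by fun_prop)] at h2
      simpa [Function.comp_def] using h2.symm
    refine Measure.measurable_of_measurable_coe _ fun B hB => ?_
    have hf : Measurable (fun q : (ℝ × ℝ) × ℝ => q.1.1 + q.1.2 * q.2) := by fun_prop
    have : (fun p : ℝ × ℝ => gaussianReal p.1 (NNReal.mk (p.2 ^ 2) (sq_nonneg p.2)) B) =
        fun p => gaussianReal 0 1 (Prod.mk p ⁻¹' ((fun q : (ℝ × ℝ) × ℝ =>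
          q.1.1 + q.1.2 * q.2) ⁻¹' B)) := by
      funext p
      rw [key p, Measure.map_apply (by fun_prop) hB]
      rfl
    rw [this]
    exact measurable_measure_prodMk_left (hf hB)

/-- The mixture `ν_φ (B) = ∫ N(m, σ)(B) dφ(m, σ)` with mixing measure `φ`. -/
def mixture (φ : Measure (ℝ × ℝ)) : Measure ℝ := φ.bind gaussianKernel

/-- `φ ∈ 𝒫(S)`: a Borel probability measure on the plane carried by `S`. -/
structure IsProbOn (S : Set (ℝ × ℝ)) (φ : Measure (ℝ × ℝ)) : Prop where
  prob : IsProbabilityMeasure φ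
  carried : φ Sᶜ = 0

/-- `μ` is a mixture of Gaussian measures, all with parameters in `S`. -/
def IsGaussianMixture (S : Set (ℝ × ℝ)) (μ : Measure ℝ) : Prop :=
  ∃ φ : Measure (ℝ × ℝ), IsProbOn S φ ∧ μ = mixture φ

/-- `φ` is `r`-atomic: a combination with positive weights of the Dirac masses at `r` distinct
points. -/
def IsAtomic (r : ℕ) (φ : Measure (ℝ × ℝ)) : Prop :=
  ∃ (A : Finset (ℝ × ℝ)) (w : ℝ × ℝ → ℝ≥0), A.card = r ∧ (∀ a ∈ A, 0 < w a) ∧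
    φ = ∑ a ∈ A, w a • Measure.dirac a

/-! ### The optimal transport problem -/

/-- Feasible pairs: `φ ∈ 𝒫(S)` and `lam ∈ 𝒫(ℝ²)` with marginals `μ` and `ν_φ`. -/
structure OTFeasible (μ : Measure ℝ) (S : Set (ℝ × ℝ))
    (lam φ : Measure (ℝ × ℝ)) : Prop where
  mixing : IsProbOn S φ
  prob : IsProbabilityMeasure lam
  fst : lam.map Prod.fst = μ
  snd : lam.map Prod.snd = mixture φ

/-- The quadratic transport cost `∫ (x - y)² dlam`. -/
def otCost (lam : Measure (ℝ × ℝ)) : ℝ≥0∞ := ∫⁻ p, ENNReal.ofReal ((p.1 - p.2) ^ 2) ∂lam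

/-- The optimal value `τ` (infinite if there is no feasible pair). -/
def otValue (μ : Measure ℝ) (S : Set (ℝ × ℝ)) : ℝ≥0∞ :=
  ⨅ (lam : Measure (ℝ × ℝ)) (φ : Measure (ℝ × ℝ)) (_ : OTFeasible μ S lam φ), otCost lam

/-- `(lam, φ)` is an optimal solution of the optimal transport problem. -/
def OTOptimal (μ : Measure ℝ) (S : Set (ℝ × ℝ)) (lam φ : Measure (ℝ × ℝ)) : Prop :=
  OTFeasible μ S lam φ ∧ otCost lam = otValue μ S

/-- The coupling of `μ` with itself carried by the diagonal, i.e. the image of `μ` under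
`x ↦ (x, x)`. -/
def diagCoupling (μ : Measure ℝ) : Measure (ℝ × ℝ) := μ.map (fun x => (x, x))

/-! ### Pseudo-moments, Riesz functional, moment and localizing matrices -/

/-- Bivariate polynomials; `X 0`, `X 1` stand for `x, y` or for `m, σ`. -/
abbrev Poly := MvPolynomial (Fin 2) ℝ

/-- `ℕ²ₙ`, the pairs `(i, j)` with `i + j ≤ n`. -/
def idx (n : ℕ) : Finset (ℕ × ℕ) :=
  (Finset.range (n + 1) ×ˢ Finset.range (n + 1)).filter fun α => α.1 + α.2 ≤ n

/-- Completion with zeros of a vector indexed by `ℕ²ₙ` to a sequence indexed by `ℕ²`. -/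
def extend {n : ℕ} (y : idx n → ℝ) (α : ℕ × ℕ) : ℝ := if h : α ∈ idx n then y ⟨α, h⟩ else 0

/-- The Riesz functional `p = ∑ p_{ij} x^i y^j ↦ ∑ p_{ij} y_{ij}`. -/
def riesz (y : ℕ × ℕ → ℝ) (p : Poly) : ℝ := ∑ d ∈ p.support, p.coeff d * y (d 0, d 1)

/-- The sequence `g · y`, with entries `∑ g_{kl} y_{(i + k, j + l)}`. -/
def shift (g : Poly) (y : ℕ × ℕ → ℝ) (α : ℕ × ℕ) : ℝ :=
  ∑ d ∈ g.support, g.coeff d * y (α.1 + d 0, α.2 + d 1)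

/-- The moment matrix `M_n(y)`; `momentMatrix n (shift g y)` is the localizing matrix
`M_n(g · y)`. -/
def momentMatrix (n : ℕ) (y : ℕ × ℕ → ℝ) : Matrix (idx n) (idx n) ℝ :=
  Matrix.of fun α β => y (α.1 + β.1)

/-- The vector of moments of degree at most `n` of a measure on the plane. -/
def momentVec (n : ℕ) (ν : Measure (ℝ × ℝ)) : idx n → ℝ :=
  fun α => ∫ p, p.1 ^ α.1.1 * p.2 ^ α.1.2 ∂ν

/-- The polynomial `p_j(m, σ)` giving the `j`-th moment of `N(m, σ)`:
`p_j = ∑_{2k ≤ j} C(j, 2k) (2k - 1)!! σ^{2k} m^{j - 2k}`, where `(-1)!! = 1`. -/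
def gaussMoment (j : ℕ) : Poly :=
  ∑ k ∈ Finset.range (j / 2 + 1),
    MvPolynomial.C ((j.choose (2 * k) * (2 * k - 1).doubleFactorial : ℕ) : ℝ) *
      MvPolynomial.X 1 ^ (2 * k) * MvPolynomial.X 0 ^ (j - 2 * k)

/-- Value at the point `(m, σ)`. -/
def evalAt (p : Poly) (a : ℝ × ℝ) : ℝ := MvPolynomial.eval ![a.1, a.2] p

/-! ### The semi-algebraic parameter set and the semidefinite relaxations -/

/-- The basic semi-algebraic set `{(m, σ) : u_j(m, σ) ≥ 0 for all j}`. -/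
def semialgSet {s : ℕ} (u : Fin s → Poly) : Set (ℝ × ℝ) := {a | ∀ j, 0 ≤ evalAt (u j) a}

/-- `⌈deg p / 2⌉`. -/
def halfDeg (p : Poly) : ℕ := (p.totalDegree + 1) / 2

/-- `max_j ⌈deg u_j / 2⌉`: the first order of the hierarchy, and also the gap in the
flatness condition. -/
def maxHalfDeg {s : ℕ} (u : Fin s → Poly) : ℕ := Finset.univ.sup fun j => halfDeg (u j)

/-- Feasible pairs of pseudo-moment vectors for the degree-`2n` semidefinite relaxation. -/
structure RelaxFeasible (μ : Measure ℝ) {s : ℕ} (u : Fin s → Poly) (n : ℕ)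
    (lam phi : idx (2 * n) → ℝ) : Prop where
  fst : ∀ j ≤ 2 * n, extend lam (j, 0) = ∫ x, x ^ j ∂μ
  snd : ∀ j ≤ 2 * n, extend lam (0, j) - riesz (extend phi) (gaussMoment j) = 0
  psd_lam : (momentMatrix n (extend lam)).PosSemidef
  psd_phi : (momentMatrix n (extend phi)).PosSemidef
  psd_loc : ∀ j, (momentMatrix (n - halfDeg (u j)) (shift (u j) (extend phi))).PosSemidef

/-- The objective `lam((x - y)²)` of the relaxation. -/
def relaxCost {n : ℕ} (lam : idx (2 * n) → ℝ) : ℝ :=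
  riesz (extend lam) ((MvPolynomial.X 0 - MvPolynomial.X 1) ^ 2)

/-- The optimal value `τ_n` of the degree-`2n` relaxation (`+∞` if it is infeasible). -/
def relaxValue (μ : Measure ℝ) {s : ℕ} (u : Fin s → Poly) (n : ℕ) : EReal :=
  ⨅ (lam : idx (2 * n) → ℝ) (phi : idx (2 * n) → ℝ) (_ : RelaxFeasible μ u n lam phi),
    ((relaxCost lam : ℝ) : EReal)

/-- `(lam, phi)` is an optimal solution of the degree-`2n` relaxation. -/
def RelaxOptimal (μ : Measure ℝ) {s : ℕ} (u : Fin s → Poly) (n : ℕ)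
    (lam phi : idx (2 * n) → ℝ) : Prop :=
  RelaxFeasible μ u n lam phi ∧ ((relaxCost lam : ℝ) : EReal) = relaxValue μ u n

/-- The flatness condition `rank M_n(phi) = rank M_{n - v}(phi) = r`, with
`v = max_j ⌈deg u_j / 2⌉`. -/
def IsFlat {s : ℕ} (u : Fin s → Poly) (n r : ℕ) (phi : idx (2 * n) → ℝ) : Prop :=
  (momentMatrix n (extend phi)).rank = r ∧
    (momentMatrix (n - maxHalfDeg u) (extend phi)).rank = r

end GaussMix

end

open GaussMix

/-! The diagonal coupling has cost zero and second marginal `μ`, so its feasibility together with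
`φ` already says `μ = mixture φ`; optimality is then automatic. Its moments and those of `φ` are
feasible for every relaxation, and the cost is a value of the quadratic form of a positive
semidefinite matrix, hence nonnegative; so both optimal values vanish. For an `r`-atomic `φ` the
moment matrices have rank `r` as soon as polynomials of the available degree interpolate at the
atoms (`rank_momentMatrix_atomic`).

The converse rests on three facts. A flat positive semidefinite moment matrix is that of an atomic
measure (`flat_extension`): in a Gram representation, multiplication by the two variables gives
commuting symmetric operators, whose joint eigenvalues are the atoms. Squares of interpolation
polynomials, tested in the localizing matrices, put these atoms in `S` (`exists_atomic_of_isFlat`).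
Zero cost places `x - y` in the kernel of the moment matrix of `lam`, so the two marginals share
their moments up to degree `n + 1` (`moments_eq_of_relaxCost_eq_zero`). Once the higher moments
agree as well, the measures coincide: `S` is bounded, so the mixture has a finite Laplace transform
and is moment determinate (`measure_ext_of_moments`). -/

/-! ### Moment determinacy -/

/-- The power series of `cosh (t * x)` has nonnegative terms, so by Tonelli its integral depends
only on the even moments. Its finiteness therefore passes from `ν` to `μ`, and `exp ≤ 2 cosh`. -/
theorem integrable_exp_mul_of_moments_eq {μ ν : Measure ℝ}
    (hμ : ∀ j : ℕ, Integrable (fun x : ℝ => x ^ j) μ)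
    (hν : ∀ j : ℕ, Integrable (fun x : ℝ => x ^ j) ν)
    (hexp : ∀ t : ℝ, Integrable (fun x => Real.exp (t * x)) ν)
    (h : ∀ j : ℕ, ∫ x, x ^ j ∂μ = ∫ x, x ^ j ∂ν) (t : ℝ) :
    Integrable (fun x => Real.exp (t * x)) μ := by
  have key : ∀ ρ : Measure ℝ, (∀ j : ℕ, Integrable (fun x : ℝ => x ^ j) ρ) →
      ∫⁻ x, ENNReal.ofReal (Real.cosh (t * x)) ∂ρ =
        ∑' k : ℕ, ENNReal.ofReal (t ^ (2 * k) / (2 * k).factorial * ∫ x, x ^ (2 * k) ∂ρ) := by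
    intro ρ hρ
    have h1 : ∀ x : ℝ, ENNReal.ofReal (Real.cosh (t * x)) =
        ∑' k : ℕ, ENNReal.ofReal (t ^ (2 * k) / (2 * k).factorial * x ^ (2 * k)) := by
      intro x
      have hs := Real.hasSum_cosh (t * x)
      rw [← hs.tsum_eq, ENNReal.ofReal_tsum_of_nonneg _ hs.summable]
      · congr 1; ext k; congr 1; rw [mul_pow]; ring
      · intro k
        exact div_nonneg (Even.pow_nonneg ⟨k, by ring⟩ _) (by positivity)
    simp_rw [h1]
    rw [lintegral_tsum (fun k => by fun_prop)]
    congr 1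
    ext k
    rw [← integral_const_mul, ofReal_integral_eq_lintegral_ofReal ((hρ (2 * k)).const_mul _)]
    refine Filter.Eventually.of_forall fun x => ?_
    have h2 : 0 ≤ t ^ (2 * k) := Even.pow_nonneg ⟨k, by ring⟩ _
    have h3 : 0 ≤ x ^ (2 * k) := Even.pow_nonneg ⟨k, by ring⟩ _
    show 0 ≤ t ^ (2 * k) / (2 * k).factorial * x ^ (2 * k)
    positivity
  have hcν : Integrable (fun x => Real.cosh (t * x)) ν := by
    simp_rw [Real.cosh_eq]
    refine ((hexp t).add ?_).div_const 2
    simpa using hexp (-t)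
  have hfin : ∫⁻ x, ENNReal.ofReal (Real.cosh (t * x)) ∂μ < ∞ := by
    have : ∫⁻ x, ENNReal.ofReal (Real.cosh (t * x)) ∂μ =
        ∫⁻ x, ENNReal.ofReal (Real.cosh (t * x)) ∂ν := by
      rw [key μ hμ, key ν hν]; simp_rw [h]
    rw [this]
    exact hcν.lintegral_lt_top
  have hcμ : Integrable (fun x => Real.cosh (t * x)) μ :=
    ⟨(Real.continuous_cosh.comp (continuous_const_mul t)).aestronglyMeasurable,
      (hasFiniteIntegral_iff_ofReal (Filter.Eventually.of_forall fun x =>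
        (Real.cosh_pos _).le)).2 hfin⟩
  refine (hcμ.const_mul 2).mono' (by fun_prop) (Filter.Eventually.of_forall fun x => ?_)
  rw [Real.norm_eq_abs, abs_of_pos (Real.exp_pos _), Real.cosh_eq]
  have := Real.exp_pos (-(t * x))
  linarith

theorem integrableExpSet_eq_univ {μ : Measure ℝ}
    (h : ∀ t : ℝ, Integrable (fun x => Real.exp (t * x)) μ) :
    interior (integrableExpSet id μ) = Set.univ := by
  have : integrableExpSet id μ = Set.univ := Set.eq_univ_of_forall fun t => h t
  rw [this, interior_univ]

theorem integrable_pow_of_integrable_exp {μ : Measure ℝ}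
    (h : ∀ t : ℝ, Integrable (fun x => Real.exp (t * x)) μ) (j : ℕ) :
    Integrable (fun x : ℝ => x ^ j) μ :=
  integrable_pow_of_integrable_exp_mul (X := id) one_ne_zero (h 1) (h (-1)) j

/-- A probability measure with everywhere finite Laplace transform is determined by its moments. -/
theorem measure_ext_of_moments {μ ν : Measure ℝ} [IsProbabilityMeasure μ] [IsProbabilityMeasure ν]
    (hμ : ∀ j : ℕ, Integrable (fun x : ℝ => x ^ j) μ)
    (hexp : ∀ t : ℝ, Integrable (fun x => Real.exp (t * x)) ν)
    (h : ∀ j : ℕ, ∫ x, x ^ j ∂μ = ∫ x, x ^ j ∂ν) : μ = ν := by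
  have hμe := integrable_exp_mul_of_moments_eq hμ (integrable_pow_of_integrable_exp hexp) hexp h
  have iμ := integrableExpSet_eq_univ hμe
  have iν := integrableExpSet_eq_univ hexp
  -- The Taylor coefficients at 0 are the moments up to factorials, so the two functions agree near
  -- 0, and then everywhere by the identity theorem.
  have hmgf : mgf id μ = mgf id ν := by
    have hp := hasFPowerSeriesAt_mgf (X := id) (μ := μ) (v := 0) (by rw [iμ]; trivial)
    have hq := hasFPowerSeriesAt_mgf (X := id) (μ := ν) (v := 0) (by rw [iν]; trivial)
    have he : (fun n : ℕ => (μ[fun ω : ℝ => id ω ^ n * Real.exp (0 * id ω)] : ℝ) / n.factorial) =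
        fun n : ℕ => (ν[fun ω : ℝ => id ω ^ n * Real.exp (0 * id ω)] : ℝ) / n.factorial := by
      funext n; simp [h n]
    rw [he] at hp
    have hev : mgf id μ =ᶠ[nhds 0] mgf id ν := by
      filter_upwards [hp.eventually_hasSum, hq.eventually_hasSum] with y h1 h2
      simpa using h1.unique h2
    have aμ : AnalyticOnNhd ℝ (mgf id μ) Set.univ := by
      rw [← iμ]; exact analyticOnNhd_mgf
    have aν : AnalyticOnNhd ℝ (mgf id ν) Set.univ := by
      rw [← iν]; exact analyticOnNhd_mgf
    exact aμ.eq_of_eventuallyEq aν hev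
  -- The strip of agreement is the whole plane because the Laplace transforms are finite on all of
  -- `ℝ`; in particular it contains the imaginary axis, that is, the characteristic functions.
  have := eqOn_complexMGF_of_mgf hmgf
  refine Measure.ext_of_complexMGF_id_eq (funext fun z => this ?_)
  simp [iμ]

/-! ### Moments of Gaussian laws and of their mixtures -/

theorem gaussianKernel_eq_map (p : ℝ × ℝ) :
    gaussianKernel p = (gaussianReal 0 1).map (fun z : ℝ => p.1 + p.2 * z) := by
  have h1 := gaussianReal_map_const_mul (μ := 0) (v := 1) p.2
  have h2 := gaussianReal_map_const_add (μ := p.2 * 0)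
    (v := NNReal.mk (p.2 ^ 2) (sq_nonneg p.2) * 1) p.1
  rw [← h1, Measure.map_map (by fun_prop) (by fun_prop)] at h2
  simpa [Function.comp_def, gaussianKernel] using h2.symm

instance isMarkovKernel_gaussianKernel : IsMarkovKernel gaussianKernel :=
  ⟨fun p => by
    show IsProbabilityMeasure (gaussianReal p.1 (NNReal.mk (p.2 ^ 2) (sq_nonneg p.2)))
    infer_instance⟩

theorem isProbabilityMeasure_mixture (φ : Measure (ℝ × ℝ)) [IsProbabilityMeasure φ] :
    IsProbabilityMeasure (mixture φ) := by
  unfold mixture; infer_instance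

/-- Stein's recursion for the tilted moments of the standard Gaussian law. -/
theorem stdGaussian_tilted_recursion (n : ℕ) (t : ℝ) :
    ∫ x, x ^ (n + 2) * Real.exp (t * x) ∂gaussianReal 0 1 =
      t * ∫ x, x ^ (n + 1) * Real.exp (t * x) ∂gaussianReal 0 1 +
        (n + 1) * ∫ x, x ^ n * Real.exp (t * x) ∂gaussianReal 0 1 := by
  -- Differentiation in `t` multiplies the integrand by `x`. Each instance of the recursion is thus
  -- the derivative of the previous one, starting from the explicit Laplace transform `exp (t ^ 2 /
  -- 2)`, and no integration by parts is needed.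
  have hd : ∀ (k : ℕ) (t : ℝ), HasDerivAt (fun t => ∫ x, x ^ k * Real.exp (t * x) ∂gaussianReal 0 1)
      (∫ x, x ^ (k + 1) * Real.exp (t * x) ∂gaussianReal 0 1) t := fun k t =>
    hasDerivAt_integral_pow_mul_exp_real (X := id) (μ := gaussianReal 0 1)
      (by rw [integrableExpSet_id_gaussianReal, interior_univ]; trivial) k
  have h0 : ∀ t : ℝ, ∫ x, x ^ 0 * Real.exp (t * x) ∂gaussianReal 0 1 = Real.exp (t ^ 2 / 2) := by
    intro t
    have := congrFun (mgf_id_gaussianReal (μ := 0) (v := 1)) t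
    simpa [mgf] using this
  have h1 : ∀ t : ℝ, ∫ x, x ^ 1 * Real.exp (t * x) ∂gaussianReal 0 1 =
      t * ∫ x, x ^ 0 * Real.exp (t * x) ∂gaussianReal 0 1 := by
    intro t
    refine (hd 0 t).unique ?_
    rw [h0, funext h0]
    have := (((hasDerivAt_id t).pow 2).div_const 2).exp
    convert! this using 1
    simp; ring
  induction n generalizing t with
  | zero =>
    refine (hd 1 t).unique ?_
    rw [funext h1]
    refine ((hasDerivAt_id t).mul (hd 0 t)).congr_deriv ?_
    simp; ring
  | succ n ih =>
    refine (hd (n + 2) t).unique ?_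
    rw [funext ih]
    refine (((hasDerivAt_id t).mul (hd (n + 1) t)).add ((hd n t).const_mul ((n : ℝ) + 1))).congr_deriv ?_
    push_cast
    simp only [id]
    ring

theorem stdGaussian_moment_recursion (n : ℕ) :
    ∫ x, x ^ (n + 2) ∂gaussianReal 0 1 = (n + 1) * ∫ x, x ^ n ∂gaussianReal 0 1 := by
  simpa using stdGaussian_tilted_recursion n 0

theorem stdGaussian_moment_even (k : ℕ) :
    ∫ x, x ^ (2 * k) ∂gaussianReal 0 1 = ((2 * k - 1).doubleFactorial : ℝ) := by
  induction k with
  | zero => simp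
  | succ k ih =>
    rw [show 2 * (k + 1) = 2 * k + 2 by ring, stdGaussian_moment_recursion, ih]
    rcases k with _ | k
    · simp
    · rw [show 2 * (k + 1) + 2 - 1 = (2 * k + 1) + 2 by omega,
        show 2 * (k + 1) - 1 = 2 * k + 1 by omega, Nat.doubleFactorial_add_two]
      push_cast; ring

theorem stdGaussian_moment_odd (k : ℕ) : ∫ x, x ^ (2 * k + 1) ∂gaussianReal 0 1 = 0 := by
  induction k with
  | zero => simp
  | succ k ih =>
    rw [show 2 * (k + 1) + 1 = (2 * k + 1) + 2 by ring, stdGaussian_moment_recursion, ih, mul_zero]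

theorem sum_range_eq_sum_even (f : ℕ → ℝ) (hf : ∀ k, f (2 * k + 1) = 0) (j : ℕ) :
    ∑ i ∈ Finset.range (j + 1), f i = ∑ k ∈ Finset.range (j / 2 + 1), f (2 * k) := by
  induction j using Nat.twoStepInduction with
  | zero => simp
  | one => simpa [Finset.sum_range_succ] using hf 0
  | more j ih _ =>
    rw [show (j + 2) / 2 + 1 = (j / 2 + 1) + 1 by omega, Finset.sum_range_succ _ (j / 2 + 1), ← ih,
      Finset.sum_range_succ, Finset.sum_range_succ, add_assoc]
    congr 1
    -- Of the two new indices `j + 1` and `j + 2`, the odd one contributes nothing.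
    rcases Nat.even_or_odd' j with ⟨k, rfl | rfl⟩
    · rw [hf, show 2 * (2 * k / 2 + 1) = 2 * k + 1 + 1 by omega, zero_add]
    · rw [show 2 * k + 1 + 1 + 1 = 2 * (k + 1) + 1 by ring, hf, add_zero]
      congr 1; omega

theorem evalAt_gaussMoment (j : ℕ) (a : ℝ × ℝ) :
    evalAt (gaussMoment j) a = ∑ k ∈ Finset.range (j / 2 + 1),
      ((j.choose (2 * k) : ℝ) * (2 * k - 1).doubleFactorial) * a.2 ^ (2 * k) * a.1 ^ (j - 2 * k) := by
  simp [evalAt, gaussMoment, Nat.cast_mul]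

theorem integrable_pow_stdGaussian (j : ℕ) : Integrable (fun x : ℝ => x ^ j) (gaussianReal 0 1) :=
  integrable_pow_of_integrable_exp (fun t => integrable_exp_mul_gaussianReal t) j

/-- Binomial expansion of `(m + σ z) ^ j` under the standard Gaussian, whose odd moments vanish. -/
theorem integral_pow_gaussianKernel (j : ℕ) (a : ℝ × ℝ) :
    ∫ x, x ^ j ∂gaussianKernel a = evalAt (gaussMoment j) a := by
  rw [gaussianKernel_eq_map, integral_map (by fun_prop) (by fun_prop), evalAt_gaussMoment]
  simp_rw [add_comm a.1, add_pow, mul_pow]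
  rw [integral_finsetSum]
  · have : ∀ i ∈ Finset.range (j + 1),
        ∫ x, a.2 ^ i * x ^ i * a.1 ^ (j - i) * (j.choose i : ℝ) ∂gaussianReal 0 1 =
        (j.choose i : ℝ) * a.2 ^ i * a.1 ^ (j - i) * ∫ x, x ^ i ∂gaussianReal 0 1 := by
      intro i _
      rw [← integral_const_mul]
      congr 1; ext x; ring
    rw [Finset.sum_congr rfl this, sum_range_eq_sum_even]
    · refine Finset.sum_congr rfl fun k _ => ?_
      rw [stdGaussian_moment_even]; ring
    · intro k; rw [stdGaussian_moment_odd, mul_zero]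
  · intro i _
    exact (((integrable_pow_stdGaussian i).const_mul _).mul_const _).mul_const _

theorem integral_exp_gaussianKernel (t : ℝ) (a : ℝ × ℝ) :
    ∫ x, Real.exp (t * x) ∂gaussianKernel a = Real.exp (a.1 * t + a.2 ^ 2 * t ^ 2 / 2) :=
  congrFun (mgf_id_gaussianReal (μ := a.1) (v := NNReal.mk (a.2 ^ 2) (sq_nonneg a.2))) t

/-- The Laplace transform of a single Gaussian is continuous in its parameters, hence bounded on a
disc. This is where boundedness of the parameter set yields determinacy of the mixture. -/
theorem integrable_exp_mixture {φ : Measure (ℝ × ℝ)} [IsProbabilityMeasure φ] {R : ℝ}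
    (hφ : ∀ᵐ a ∂φ, a.1 ^ 2 + a.2 ^ 2 ≤ R ^ 2) (t : ℝ) :
    Integrable (fun x => Real.exp (t * x)) (mixture φ) := by
  unfold mixture
  rw [Measure.integrable_comp_iff (by fun_prop)]
  constructor
  · exact Filter.Eventually.of_forall fun a =>
      integrable_exp_mul_gaussianReal (μ := a.1) (v := NNReal.mk (a.2 ^ 2) (sq_nonneg a.2)) t
  · simp only [Real.norm_eq_abs, Real.abs_exp, integral_exp_gaussianKernel]
    refine Integrable.of_bound (by fun_prop) (Real.exp (|R| * |t| + R ^ 2 * t ^ 2 / 2)) ?_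
    filter_upwards [hφ] with a ha
    rw [Real.norm_eq_abs, Real.abs_exp, Real.exp_le_exp]
    have h1 : a.1 * t ≤ |R| * |t| := by
      refine (le_abs_self _).trans ?_
      rw [abs_mul]
      exact mul_le_mul_of_nonneg_right (sq_le_sq.1 (by nlinarith [sq_nonneg a.2])) (abs_nonneg _)
    have h2 : a.2 ^ 2 * t ^ 2 ≤ R ^ 2 * t ^ 2 :=
      mul_le_mul_of_nonneg_right (by nlinarith [sq_nonneg a.1]) (sq_nonneg _)
    linarith

theorem integral_pow_mixture {φ : Measure (ℝ × ℝ)} [IsProbabilityMeasure φ] {R : ℝ}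
    (hφ : ∀ᵐ a ∂φ, a.1 ^ 2 + a.2 ^ 2 ≤ R ^ 2) (j : ℕ) :
    ∫ x, x ^ j ∂mixture φ = ∫ a, evalAt (gaussMoment j) a ∂φ := by
  have hint : Integrable (fun x : ℝ => x ^ j) (mixture φ) :=
    integrable_pow_of_integrable_exp (integrable_exp_mixture hφ) j
  unfold mixture at hint ⊢
  rw [Measure.comp_eq_comp_const_apply] at hint ⊢
  rw [Kernel.integral_comp hint]
  simp_rw [integral_pow_gaussianKernel]
  simp

/-! ### Flat extensions of moment matrices -/

theorem mem_idx {n : ℕ} {α : ℕ × ℕ} : α ∈ idx n ↔ α.1 + α.2 ≤ n := by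
  simp only [idx, Finset.mem_filter, Finset.mem_product, Finset.mem_range]
  omega

theorem idx_mono {k n : ℕ} (h : k ≤ n) {α : ℕ × ℕ} (hα : α ∈ idx k) : α ∈ idx n :=
  mem_idx.2 ((mem_idx.1 hα).trans h)

theorem add_mem_idx {k l : ℕ} {α β : ℕ × ℕ} (hα : α ∈ idx k) (hβ : β ∈ idx l) :
    α + β ∈ idx (k + l) := by
  rw [mem_idx] at *
  simp only [Prod.fst_add, Prod.snd_add]
  omega

theorem exists_add_of_mem_idx_two_mul {n : ℕ} {γ : ℕ × ℕ} (hγ : γ ∈ idx (2 * n)) :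
    ∃ α ∈ idx n, ∃ β ∈ idx n, α + β = γ := by
  obtain ⟨i, j⟩ := γ
  rw [mem_idx] at hγ
  simp only at hγ
  rcases le_total n i with h | h
  · exact ⟨(n, 0), by simp [mem_idx], (i - n, j), by simp only [mem_idx]; omega,
      by ext <;> simp; omega⟩
  · refine ⟨(i, min j (n - i)), by simp only [mem_idx]; omega, (0, j - min j (n - i)),
      by simp only [mem_idx]; omega, ?_⟩
    ext
    · simp
    · simp only [Prod.snd_add]; omega

/-- Commuting symmetric operators are simultaneously diagonalizable. The vectors `u a` are the
components of `e` in the joint eigenspaces, and `F` keeps only the nonzero ones. -/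
theorem exists_joint_eigenvectors {E : Type*} [NormedAddCommGroup E] [InnerProductSpace ℝ E]
    [FiniteDimensional ℝ E] {A B : E →ₗ[ℝ] E} (hA : A.IsSymmetric) (hB : B.IsSymmetric)
    (hAB : Commute A B) (e : E) :
    ∃ (F : Finset (ℝ × ℝ)) (u : ℝ × ℝ → E), (∀ a ∈ F, u a ≠ 0) ∧
      (∀ a, A (u a) = a.1 • u a) ∧ (∀ a, B (u a) = a.2 • u a) ∧
      (∀ a b, a ≠ b → inner ℝ (u a) (u b) = 0) ∧ e = ∑ a ∈ F, u a := by
  have htop : (⨆ i : ℝ × ℝ, Module.End.eigenspace B i.2 ⊓ Module.End.eigenspace A i.1) = ⊤ := by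
    rw [iSup_prod, iSup_comm]
    exact LinearMap.IsSymmetric.iSup_iSup_eigenspace_inf_eigenspace_eq_top_of_commute hB hA hAB.symm
  have hort := LinearMap.IsSymmetric.orthogonalFamily_eigenspace_inf_eigenspace hB hA
  have he : e ∈ ⨆ i : ℝ × ℝ, Module.End.eigenspace B i.2 ⊓ Module.End.eigenspace A i.1 := by
    rw [htop]; trivial
  rw [Submodule.mem_iSup_iff_exists_finsupp] at he
  obtain ⟨f, hf, hsum⟩ := he
  refine ⟨f.support, f, fun a ha => Finsupp.mem_support_iff.1 ha,
    fun a => Module.End.mem_eigenspace_iff.1 (hf a).2,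
    fun a => Module.End.mem_eigenspace_iff.1 (hf a).1, fun a b hab => ?_, ?_⟩
  · exact hort hab ⟨f a, hf a⟩ ⟨f b, hf b⟩
  · rw [← hsum]; rfl

section Gram

variable {E : Type*} [NormedAddCommGroup E] [InnerProductSpace ℝ E]
  {m : ℕ} {v : ℕ × ℕ → E} {y : ℕ × ℕ → ℝ}

theorem eq_of_inner_eq_of_span (hspan : Submodule.span ℝ (v '' idx m) = ⊤) {x x' : E}
    (h : ∀ β ∈ idx m, inner ℝ x (v β) = inner ℝ x' (v β)) : x = x' := by
  refine ext_inner_right ℝ fun z => ?_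
  have : innerₛₗ ℝ x = innerₛₗ ℝ x' := by
    refine LinearMap.ext_on hspan ?_
    rintro _ ⟨β, hβ, rfl⟩
    exact h β hβ
  exact LinearMap.congr_fun this z

/-- Multiplication by the monomial `x^e` of degree one, on the span of a flat Gram system. -/
theorem exists_mul_operator (hspan : Submodule.span ℝ (v '' idx m) = ⊤)
    (hG : ∀ α ∈ idx (m + 1), ∀ β ∈ idx (m + 1), inner ℝ (v α) (v β) = y (α + β))
    (e : ℕ × ℕ) (he : e ∈ idx 1) :
    ∃ X : E →ₗ[ℝ] E, X.IsSymmetric ∧ ∀ α ∈ idx m, X (v α) = v (α + e) := by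
  have hm : ∀ α ∈ idx m, α ∈ idx (m + 1) := fun α h => idx_mono (by omega) h
  have hme : ∀ α ∈ idx m, α + e ∈ idx (m + 1) := fun α h => add_mem_idx h he
  let T : (idx m → ℝ) →ₗ[ℝ] E := Fintype.linearCombination ℝ (fun α : idx m => v α)
  let S : (idx m → ℝ) →ₗ[ℝ] E := Fintype.linearCombination ℝ (fun α : idx m => v (α + e))
  have hT : ∀ c, T c = ∑ α, c α • v α := fun c => rfl
  have hS : ∀ c, S c = ∑ α, c α • v (α + e) := fun c => rfl
  have hTsurj : LinearMap.range T = ⊤ := by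
    rw [Fintype.range_linearCombination, ← hspan]
    congr 1
    ext x; simp
  -- Well-definedness of the multiplication. Since inner products depend only on `α + β`, the shift
  -- by `e` can be moved to the other factor, and vectors of degree at most `m` suffice to test
  -- equality because they span.
  have hker : ∀ c, T c = 0 → S c = 0 := by
    intro c hc
    refine eq_of_inner_eq_of_span hspan fun β hβ => ?_
    have : inner ℝ (S c) (v β) = inner ℝ (T c) (v (β + e)) := by
      rw [hS, hT, sum_inner, sum_inner]
      refine Finset.sum_congr rfl fun α _ => ?_
      rw [real_inner_smul_left, real_inner_smul_left, hG _ (hme _ α.2) _ (hm _ hβ),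
        hG _ (hm _ α.2) _ (hme _ hβ)]
      congr 2
      abel
    rw [this, hc, inner_zero_left, inner_zero_left]
  -- By `hker`, the operator `S ∘ₗ g` does not depend on the chosen section `g`.
  obtain ⟨g, hg⟩ := T.exists_rightInverse_of_surjective hTsurj
  have hX : ∀ c, (S ∘ₗ g) (T c) = S c := by
    intro c
    have h1 : T (g (T c)) = T c := LinearMap.congr_fun hg (T c)
    have h2 := hker (g (T c) - c) (by rw [map_sub, h1, sub_self])
    rw [map_sub, sub_eq_zero] at h2
    exact h2
  have hXv : ∀ α ∈ idx m, (S ∘ₗ g) (v α) = v (α + e) := by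
    classical
    intro α hα
    have h1 : T (Pi.single ⟨α, hα⟩ 1) = v α := by
      simp [T, Fintype.linearCombination_apply_single]
    have h2 : S (Pi.single ⟨α, hα⟩ 1) = v (α + e) := by
      simp [S, Fintype.linearCombination_apply_single]
    rw [← h1, hX, h2]
  refine ⟨S ∘ₗ g, ?_, hXv⟩
  intro x x'
  obtain ⟨c, rfl⟩ : ∃ c, T c = x := LinearMap.range_eq_top.1 hTsurj x
  obtain ⟨d, rfl⟩ : ∃ d, T d = x' := LinearMap.range_eq_top.1 hTsurj x'
  rw [hX, hX, hS, hT, hT, hS]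
  simp only [sum_inner, inner_sum, real_inner_smul_left, real_inner_smul_right]
  refine Finset.sum_congr rfl fun α _ => Finset.sum_congr rfl fun β _ => ?_
  rw [hG _ (hme _ β.2) _ (hm _ α.2), hG _ (hm _ β.2) _ (hme _ α.2)]
  congr 3
  abel

/-- Here `v (0, 0)` plays the role of the constant 1 and `v (i, j)` is `X ^ i Y ^ j` applied to it.
Decomposing 1 into joint eigenvectors turns each monomial into its values at the joint eigenvalues.
-/
theorem exists_atomic_decomposition [FiniteDimensional ℝ E]
    (hspan : Submodule.span ℝ (v '' idx m) = ⊤)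
    (hG : ∀ α ∈ idx (m + 1), ∀ β ∈ idx (m + 1), inner ℝ (v α) (v β) = y (α + β)) :
    ∃ (F : Finset (ℝ × ℝ)) (u : ℝ × ℝ → E), (∀ a ∈ F, u a ≠ 0) ∧
      (∀ a b, a ≠ b → inner ℝ (u a) (u b) = 0) ∧
      ∀ α ∈ idx (m + 1), v α = ∑ a ∈ F, (a.1 ^ α.1 * a.2 ^ α.2) • u a := by
  have hm : ∀ α ∈ idx m, α ∈ idx (m + 1) := fun α h => idx_mono (by omega) h
  have h10 : ((1, 0) : ℕ × ℕ) ∈ idx 1 := by simp [mem_idx]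
  have h01 : ((0, 1) : ℕ × ℕ) ∈ idx 1 := by simp [mem_idx]
  obtain ⟨X, hXs, hX⟩ := exists_mul_operator hspan hG (1, 0) h10
  obtain ⟨Y, hYs, hY⟩ := exists_mul_operator hspan hG (0, 1) h01
  have hcomm : Commute X Y := by
    refine LinearMap.ext_on hspan ?_
    rintro _ ⟨α, hα, rfl⟩
    refine eq_of_inner_eq_of_span hspan fun β hβ => ?_
    show inner ℝ (X (Y (v α))) (v β) = inner ℝ (Y (X (v α))) (v β)
    rw [hXs, hYs (X (v α)), hX _ hα, hY _ hα, hX _ hβ, hY _ hβ,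
      hG _ (add_mem_idx hα h01) _ (add_mem_idx hβ h10),
      hG _ (add_mem_idx hα h10) _ (add_mem_idx hβ h01)]
    congr 1
    abel
  obtain ⟨F, u, hu0, hXu, hYu, hort, hsum⟩ := exists_joint_eigenvectors hXs hYs hcomm (v (0, 0))
  refine ⟨F, u, hu0, hort, ?_⟩
  -- The operators are known to shift only vectors of degree at most `m`, so the climb stops exactly
  -- at degree `m + 1`.
  have hcol : ∀ j ≤ m + 1, v (0, j) = ∑ a ∈ F, (a.2 ^ j) • u a := by
    intro j
    induction j with
    | zero => intro _; simpa using hsum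
    | succ j ih =>
      intro hj
      have : v (0, j + 1) = Y (v (0, j)) := (hY (0, j) (by simp only [mem_idx]; omega)).symm
      rw [this, ih (by omega), map_sum]
      refine Finset.sum_congr rfl fun a _ => ?_
      rw [map_smul, hYu, smul_smul, pow_succ]
  rintro ⟨i, j⟩ hij
  rw [mem_idx] at hij
  simp only at hij ⊢
  induction i with
  | zero => simpa using hcol j (by omega)
  | succ i ih =>
    have : v (i + 1, j) = X (v (i, j)) := (hX (i, j) (by simp only [mem_idx]; omega)).symm
    rw [this, ih (by omega), map_sum]
    refine Finset.sum_congr rfl fun a _ => ?_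
    rw [map_smul, hXu, smul_smul]
    congr 1
    ring

/-- The weights are the squared norms of the orthogonal components of `v (0, 0)`, and these
components form a basis of `E`. Since vectors of degree at most `k` already span, each component is
a combination of them; reading coordinates in the basis makes the coefficients an interpolation
polynomial of degree at most `k`. -/
theorem flat_gram_system [FiniteDimensional ℝ E] {k : ℕ} (hk : k ≤ m)
    (hspan : Submodule.span ℝ (v '' idx k) = ⊤)
    (hG : ∀ α ∈ idx (m + 1), ∀ β ∈ idx (m + 1), inner ℝ (v α) (v β) = y (α + β)) :
    ∃ (F : Finset (ℝ × ℝ)) (w : ℝ × ℝ → ℝ), F.card = Module.finrank ℝ E ∧ (∀ a ∈ F, 0 < w a) ∧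
      (∀ γ ∈ idx (2 * (m + 1)), y γ = ∑ a ∈ F, w a * (a.1 ^ γ.1 * a.2 ^ γ.2)) ∧
      ∀ a ∈ F, ∃ c : idx k → ℝ, ∀ b ∈ F,
        ∑ α, c α * (b.1 ^ α.1.1 * b.2 ^ α.1.2) = if b = a then 1 else 0 := by
  have hspan' : Submodule.span ℝ (v '' idx m) = ⊤ := by
    rw [eq_top_iff, ← hspan]
    exact Submodule.span_mono (Set.image_mono fun α hα => idx_mono hk hα)
  obtain ⟨F, u, hu0, hort, hv⟩ := exists_atomic_decomposition hspan' hG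
  have hin : ∀ (f : ℝ × ℝ → ℝ), ∀ b ∈ F, inner ℝ (∑ a ∈ F, f a • u a) (u b) = f b * ‖u b‖ ^ 2 := by
    intro f b hb
    rw [sum_inner, Finset.sum_eq_single b]
    · rw [real_inner_smul_left, real_inner_self_eq_norm_sq]
    · intro a _ hab
      rw [real_inner_smul_left, hort a b hab, mul_zero]
    · exact fun h => (h hb).elim
  refine ⟨F, fun a => ‖u a‖ ^ 2, ?_, fun a ha => pow_pos (norm_pos_iff.2 (hu0 a ha)) 2, ?_, ?_⟩
  · apply le_antisymm
    · have hli : LinearIndependent ℝ (fun a : F => u a) :=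
        linearIndependent_of_ne_zero_of_inner_eq_zero (fun a => hu0 a a.2)
          fun a b hab => hort _ _ fun h => hab (Subtype.ext h)
      simpa using hli.fintype_card_le_finrank
    · have htop : Submodule.span ℝ (Set.range fun a : F => u a) = ⊤ := by
        rw [eq_top_iff, ← hspan', Submodule.span_le]
        rintro _ ⟨α, hα, rfl⟩
        rw [hv α (idx_mono (by omega) hα)]
        exact Submodule.sum_mem _ fun a ha => Submodule.smul_mem _ _
          (Submodule.subset_span ⟨⟨a, ha⟩, rfl⟩)
      have := finrank_range_le_card (R := ℝ) (fun a : F => u a)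
      rw [Set.finrank, htop, finrank_top] at this
      simpa using this
  · intro γ hγ
    obtain ⟨α, hα, β, hβ, rfl⟩ := exists_add_of_mem_idx_two_mul hγ
    rw [← hG α hα β hβ, hv β hβ, inner_sum]
    refine Finset.sum_congr rfl fun b hb => ?_
    rw [real_inner_smul_right, hv α hα, hin _ b hb]
    simp only [Prod.fst_add, Prod.snd_add]
    ring
  · intro a ha
    have hmem : u a ∈ Submodule.span ℝ (Set.range fun α : idx k => v α) := by
      have : (Set.range fun α : idx k => v α) = v '' idx k := by ext x; simp
      rw [this, hspan]; trivial
    obtain ⟨c, hc⟩ := (Submodule.mem_span_range_iff_exists_fun ℝ).1 hmem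
    refine ⟨c, fun b hb => ?_⟩
    have h1 : u a = ∑ b ∈ F, (∑ α, c α * (b.1 ^ α.1.1 * b.2 ^ α.1.2)) • u b := by
      rw [← hc]
      simp_rw [Finset.sum_smul]
      rw [Finset.sum_comm]
      refine Finset.sum_congr rfl fun α _ => ?_
      rw [hv α (idx_mono (by omega) α.2), Finset.smul_sum]
      simp_rw [smul_smul]
    have h2 := hin (fun b => ∑ α, c α * (b.1 ^ α.1.1 * b.2 ^ α.1.2)) b hb
    rw [← h1] at h2
    have hpos : 0 < ‖u b‖ ^ 2 := pow_pos (norm_pos_iff.2 (hu0 b hb)) 2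
    split_ifs with hba
    · subst hba
      rw [real_inner_self_eq_norm_sq] at h2
      exact mul_right_cancel₀ hpos.ne' (by rw [← h2, one_mul])
    · rw [hort a b (Ne.symm hba)] at h2
      exact (mul_eq_zero.1 h2.symm).resolve_right hpos.ne'

end Gram

open scoped MatrixOrder in
-- The vectors are the columns of a factor `B` with `M = Bᴴ B`. Truncation to order `k` keeps some
-- of the columns, and a Gram matrix has the rank of its column system.
theorem exists_gram_system {n : ℕ} {y : ℕ × ℕ → ℝ} (hpsd : (momentMatrix n y).PosSemidef) :
    ∃ v : ℕ × ℕ → EuclideanSpace ℝ (idx n),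
      (∀ α ∈ idx n, ∀ β ∈ idx n, inner ℝ (v α) (v β) = y (α + β)) ∧ (∀ α ∉ idx n, v α = 0) ∧
      ∀ k ≤ n, (momentMatrix k y).rank =
        Module.finrank ℝ (Submodule.span ℝ (v '' idx k)) := by
  obtain ⟨B, hB⟩ := CStarAlgebra.nonneg_iff_eq_star_mul_self.mp hpsd.nonneg
  have hBe : ∀ α β : idx n, ∑ i, B i α * B i β = y (α.1 + β.1) := by
    intro α β
    have := congrFun (congrFun hB α) β
    simpa [momentMatrix, Matrix.mul_apply, Matrix.star_apply] using this.symm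
  let v : ℕ × ℕ → EuclideanSpace ℝ (idx n) := fun α =>
    if h : α ∈ idx n then WithLp.toLp 2 (fun i => B i ⟨α, h⟩) else 0
  have hv : ∀ α : idx n, v α = WithLp.toLp 2 (fun i => B i α) := fun α => dif_pos α.2
  refine ⟨v, ?_, fun α hα => dif_neg hα, fun k hk => ?_⟩
  · intro α hα β hβ
    have := hBe ⟨α, hα⟩ ⟨β, hβ⟩
    rw [← this, hv ⟨α, hα⟩, hv ⟨β, hβ⟩, PiLp.inner_apply]
    refine Finset.sum_congr rfl fun i _ => ?_
    simp [mul_comm]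
  · let ι : idx k → idx n := fun α => ⟨α, idx_mono hk α.2⟩
    let C : Matrix (idx n) (idx k) ℝ := B.submatrix id ι
    have hC : momentMatrix k y = C.conjTranspose * C := by
      ext α β
      simpa [momentMatrix, Matrix.mul_apply, C, ι] using (hBe (ι α) (ι β)).symm
    rw [hC, Matrix.rank_conjTranspose_mul_self, Matrix.rank_eq_finrank_span_cols]
    have himg : v '' idx k = (WithLp.linearEquiv 2 ℝ (idx n → ℝ)).symm '' Set.range C.col := by
      ext x
      constructor
      · rintro ⟨α, hα, rfl⟩
        exact ⟨_, ⟨⟨α, hα⟩, rfl⟩, (hv ⟨α, idx_mono hk hα⟩).symm⟩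
      · rintro ⟨_, ⟨α, rfl⟩, rfl⟩
        exact ⟨α, α.2, hv (ι α)⟩
    rw [himg]
    have := Submodule.map_span
      ((WithLp.linearEquiv 2 ℝ (idx n → ℝ)).symm : (idx n → ℝ) →ₗ[ℝ] EuclideanSpace ℝ (idx n))
      (Set.range C.col)
    exact (LinearEquiv.finrank_map_eq _ _).symm.trans (congrArg (fun W : Submodule ℝ
      (EuclideanSpace ℝ (idx n)) => Module.finrank ℝ W) this)

/-- The flat extension theorem of Curto and Fialkow, in two variables. -/
theorem flat_extension {n k r : ℕ} {y : ℕ × ℕ → ℝ} (hpsd : (momentMatrix n y).PosSemidef)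
    (hkn : k < n) (hn : (momentMatrix n y).rank = r) (hk : (momentMatrix k y).rank = r) :
    ∃ (F : Finset (ℝ × ℝ)) (w : ℝ × ℝ → ℝ), F.card = r ∧ (∀ a ∈ F, 0 < w a) ∧
      (∀ γ ∈ idx (2 * n), y γ = ∑ a ∈ F, w a * (a.1 ^ γ.1 * a.2 ^ γ.2)) ∧
      ∀ a ∈ F, ∃ c : idx k → ℝ, ∀ b ∈ F,
        ∑ α, c α * (b.1 ^ α.1.1 * b.2 ^ α.1.2) = if b = a then 1 else 0 := by
  obtain ⟨m, rfl⟩ : ∃ m, n = m + 1 := ⟨n - 1, by omega⟩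
  obtain ⟨v, hG, hv0, hrank⟩ := exists_gram_system hpsd
  let V := Submodule.span ℝ (v '' idx (m + 1))
  -- Flatness enters here: equal ranks force the nested spans to coincide.
  have hVk : Submodule.span ℝ (v '' idx k) = V := by
    refine Submodule.eq_of_le_of_finrank_eq
      (Submodule.span_mono (Set.image_mono fun α hα => idx_mono hkn.le hα)) ?_
    rw [← hrank k hkn.le, ← hrank _ le_rfl, hk, hn]
  have hmem : ∀ α, v α ∈ V := by
    intro α
    by_cases h : α ∈ idx (m + 1)
    · exact Submodule.subset_span ⟨α, h, rfl⟩
    · rw [hv0 α h]; exact V.zero_mem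
  let v' : ℕ × ℕ → V := fun α => ⟨v α, hmem α⟩
  have hspan : Submodule.span ℝ (v' '' idx k) = ⊤ := by
    apply Submodule.map_injective_of_injective V.injective_subtype
    rw [Submodule.map_span, Submodule.map_top, Submodule.range_subtype, ← Set.image_comp]
    exact hVk
  have hfr : Module.finrank ℝ V = r := by rw [← hn, hrank _ le_rfl]
  have := flat_gram_system (y := y) (v := v') (m := m) (k := k) (by omega) hspan
    (fun α hα β hβ => hG α hα β hβ)
  rwa [hfr] at this

/-! ### Riesz functionals and moment matrices of measures -/

theorem evalAt_eq_sum (p : Poly) (a : ℝ × ℝ) :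
    evalAt p a = ∑ d ∈ p.support, p.coeff d * (a.1 ^ d 0 * a.2 ^ d 1) := by
  simp [evalAt, MvPolynomial.eval_eq', Fin.prod_univ_two]

theorem continuous_evalAt (p : Poly) : Continuous (evalAt p) := by
  rw [funext (evalAt_eq_sum p)]
  fun_prop

theorem degree_pair_mem_idx {p : Poly} {d : Fin 2 →₀ ℕ} (hd : d ∈ p.support) :
    (d 0, d 1) ∈ idx p.totalDegree := by
  rw [mem_idx]
  have := MvPolynomial.le_totalDegree hd
  rwa [Finsupp.sum_fintype _ _ (fun _ => rfl), Fin.sum_univ_two] at this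

theorem riesz_eq_sum (y : ℕ × ℕ → ℝ) {p : Poly} {T : Finset (Fin 2 →₀ ℕ)} (hT : p.support ⊆ T) :
    riesz y p = ∑ d ∈ T, p.coeff d * y (d 0, d 1) := by
  refine Finset.sum_subset hT fun d _ hd => ?_
  rw [MvPolynomial.notMem_support_iff.1 hd, zero_mul]

theorem riesz_add (y : ℕ × ℕ → ℝ) (p q : Poly) : riesz y (p + q) = riesz y p + riesz y q := by
  classical
  rw [riesz_eq_sum y (T := p.support ∪ q.support) MvPolynomial.support_add,
    riesz_eq_sum y (T := p.support ∪ q.support) (p := p) Finset.subset_union_left,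
    riesz_eq_sum y (T := p.support ∪ q.support) (p := q) Finset.subset_union_right,
    ← Finset.sum_add_distrib]
  refine Finset.sum_congr rfl fun d _ => ?_
  rw [MvPolynomial.coeff_add, add_mul]

theorem riesz_monomial (y : ℕ × ℕ → ℝ) (d : Fin 2 →₀ ℕ) (c : ℝ) :
    riesz y (MvPolynomial.monomial d c) = c * y (d 0, d 1) := by
  rw [riesz_eq_sum y (T := {d}) MvPolynomial.support_monomial_subset]
  simp

theorem relaxCost_eq {n : ℕ} (lam : idx (2 * n) → ℝ) :
    relaxCost lam = extend lam (2, 0) - 2 * extend lam (1, 1) + extend lam (0, 2) := by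
  have : ((MvPolynomial.X 0 - MvPolynomial.X 1) ^ 2 : Poly) =
      MvPolynomial.monomial (Finsupp.single 0 2) 1 +
        MvPolynomial.monomial (Finsupp.single 0 1 + Finsupp.single 1 1) (-2) +
        MvPolynomial.monomial (Finsupp.single 1 2) 1 := by
    have h1 : (MvPolynomial.monomial (Finsupp.single 0 1 + Finsupp.single 1 1) (-2) : Poly) =
        MvPolynomial.C (-2) * (MvPolynomial.X 0 * MvPolynomial.X 1) := by
      simp [MvPolynomial.X, MvPolynomial.monomial_mul, MvPolynomial.C_mul_monomial]
    rw [← MvPolynomial.X_pow_eq_monomial, ← MvPolynomial.X_pow_eq_monomial, h1, map_neg]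
    simp only [map_ofNat]
    ring
  rw [relaxCost, this, riesz_add, riesz_add, riesz_monomial, riesz_monomial, riesz_monomial]
  simp
  ring

/-- Ensures that the Riesz functional on `gaussMoment j`, for `j ≤ 2 * n`, reads only genuine
entries and never the zero padding of `extend`. -/
theorem totalDegree_gaussMoment_le (j : ℕ) : (gaussMoment j).totalDegree ≤ j := by
  refine MvPolynomial.totalDegree_finsetSum_le fun k hk => ?_
  refine (MvPolynomial.totalDegree_mul _ _).trans ?_
  have h1 := MvPolynomial.totalDegree_mul
    (MvPolynomial.C ((j.choose (2 * k) * (2 * k - 1).doubleFactorial : ℕ) : ℝ) : Poly)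
    (MvPolynomial.X 1 ^ (2 * k))
  rw [MvPolynomial.totalDegree_C, MvPolynomial.totalDegree_X_pow] at h1
  rw [MvPolynomial.totalDegree_X_pow]
  have := Finset.mem_range.1 hk
  omega

section MeasureMoments

variable {ν : Measure (ℝ × ℝ)} {y : ℕ × ℕ → ℝ} {N : ℕ}

theorem extend_momentVec {γ : ℕ × ℕ} (hγ : γ ∈ idx N) :
    extend (momentVec N ν) γ = ∫ p, p.1 ^ γ.1 * p.2 ^ γ.2 ∂ν := dif_pos hγ

theorem riesz_eq_integral
    (hint : ∀ γ : ℕ × ℕ, Integrable (fun a : ℝ × ℝ => a.1 ^ γ.1 * a.2 ^ γ.2) ν)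
    (hy : ∀ γ ∈ idx N, y γ = ∫ a, a.1 ^ γ.1 * a.2 ^ γ.2 ∂ν) {p : Poly} (hp : p.totalDegree ≤ N) :
    riesz y p = ∫ a, evalAt p a ∂ν := by
  simp_rw [evalAt_eq_sum]
  rw [integral_finsetSum _ fun d _ => (hint (d 0, d 1)).const_mul _]
  refine Finset.sum_congr rfl fun d hd => ?_
  rw [integral_const_mul, hy _ (idx_mono hp (degree_pair_mem_idx hd))]

theorem integrable_evalAt_mul
    (hint : ∀ γ : ℕ × ℕ, Integrable (fun a : ℝ × ℝ => a.1 ^ γ.1 * a.2 ^ γ.2) ν)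
    (p : Poly) (γ : ℕ × ℕ) :
    Integrable (fun a : ℝ × ℝ => evalAt p a * (a.1 ^ γ.1 * a.2 ^ γ.2)) ν := by
  simp_rw [evalAt_eq_sum, Finset.sum_mul]
  refine integrable_finsetSum _ fun d _ => ?_
  refine ((hint (γ + (d 0, d 1))).const_mul (p.coeff d)).congr
    (Filter.Eventually.of_forall fun a => ?_)
  simp only [Prod.fst_add, Prod.snd_add]
  ring

theorem shift_eq_integral
    (hint : ∀ γ : ℕ × ℕ, Integrable (fun a : ℝ × ℝ => a.1 ^ γ.1 * a.2 ^ γ.2) ν)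
    (hy : ∀ γ ∈ idx N, y γ = ∫ a, a.1 ^ γ.1 * a.2 ^ γ.2 ∂ν) {p : Poly} {k : ℕ}
    (hp : k + p.totalDegree ≤ N) {γ : ℕ × ℕ} (hγ : γ ∈ idx k) :
    shift p y γ = ∫ a, evalAt p a * (a.1 ^ γ.1 * a.2 ^ γ.2) ∂ν := by
  have : ∀ a : ℝ × ℝ, evalAt p a * (a.1 ^ γ.1 * a.2 ^ γ.2) =
      ∑ d ∈ p.support, p.coeff d * (a.1 ^ (γ.1 + d 0) * a.2 ^ (γ.2 + d 1)) := by
    intro a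
    rw [evalAt_eq_sum, Finset.sum_mul]
    refine Finset.sum_congr rfl fun d _ => ?_
    ring
  simp_rw [this]
  rw [integral_finsetSum _ fun d _ => (hint (γ.1 + d 0, γ.2 + d 1)).const_mul _]
  refine Finset.sum_congr rfl fun d hd => ?_
  rw [integral_const_mul, hy (γ.1 + d 0, γ.2 + d 1)
    (idx_mono hp (add_mem_idx hγ (degree_pair_mem_idx hd)))]

/-- The quadratic form of a moment matrix of the (signed) measure `f dν`. -/
theorem quadForm_momentMatrix {k : ℕ} {f : ℝ × ℝ → ℝ}
    (hint : ∀ γ : ℕ × ℕ, Integrable (fun a : ℝ × ℝ => f a * (a.1 ^ γ.1 * a.2 ^ γ.2)) ν)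
    (hy : ∀ γ ∈ idx (k + k), y γ = ∫ a, f a * (a.1 ^ γ.1 * a.2 ^ γ.2) ∂ν) (c : idx k → ℝ) :
    c ⬝ᵥ (momentMatrix k y).mulVec c =
      ∫ a, f a * (∑ α, c α * (a.1 ^ α.1.1 * a.2 ^ α.1.2)) ^ 2 ∂ν := by
  have h1 : ∀ a : ℝ × ℝ, f a * (∑ α, c α * (a.1 ^ α.1.1 * a.2 ^ α.1.2)) ^ 2 =
      ∑ α, ∑ β, c α * c β * (f a * (a.1 ^ (α.1 + β.1).1 * a.2 ^ (α.1 + β.1).2)) := by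
    intro a
    rw [sq, Finset.sum_mul_sum, Finset.mul_sum]
    refine Finset.sum_congr rfl fun α _ => ?_
    rw [Finset.mul_sum]
    refine Finset.sum_congr rfl fun β _ => ?_
    simp only [Prod.fst_add, Prod.snd_add]
    ring
  simp_rw [h1]
  rw [integral_finsetSum _ fun α _ => integrable_finsetSum _ fun β _ => (hint _).const_mul _]
  simp only [dotProduct, Matrix.mulVec, momentMatrix, Matrix.of_apply, Finset.mul_sum]
  refine Finset.sum_congr rfl fun α _ => ?_
  rw [integral_finsetSum _ fun β _ => (hint _).const_mul _]
  refine Finset.sum_congr rfl fun β _ => ?_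
  rw [integral_const_mul, hy _ (add_mem_idx α.2 β.2)]
  ring

/-- Serves moment matrices with `f = 1` and localizing matrices with `f = u_j`: the quadratic form
integrates `f` times a square. -/
theorem posSemidef_momentMatrix {k : ℕ} {f : ℝ × ℝ → ℝ} (hf : ∀ᵐ a ∂ν, 0 ≤ f a)
    (hint : ∀ γ : ℕ × ℕ, Integrable (fun a : ℝ × ℝ => f a * (a.1 ^ γ.1 * a.2 ^ γ.2)) ν)
    (hy : ∀ γ ∈ idx (k + k), y γ = ∫ a, f a * (a.1 ^ γ.1 * a.2 ^ γ.2) ∂ν) :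
    (momentMatrix k y).PosSemidef := by
  rw [Matrix.posSemidef_iff_dotProduct_mulVec]
  constructor
  · ext α β
    simp [momentMatrix, add_comm]
  · intro c
    rw [star_trivial, quadForm_momentMatrix hint hy]
    refine integral_nonneg_of_ae ?_
    filter_upwards [hf] with a ha
    exact mul_nonneg ha (sq_nonneg _)

end MeasureMoments

/-! ### Moment matrices of atomic measures -/

theorem exists_coeffs_of_totalDegree_le {p : Poly} {k : ℕ} (hp : p.totalDegree ≤ k) :
    ∃ c : idx k → ℝ, ∀ a : ℝ × ℝ, ∑ α, c α * (a.1 ^ α.1.1 * a.2 ^ α.1.2) = evalAt p a := by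
  refine ⟨fun α => ∑ d ∈ p.support with (d 0, d 1) = α.1, p.coeff d, fun a => ?_⟩
  rw [evalAt_eq_sum, ← Finset.sum_fiberwise_of_maps_to (t := idx k) (g := fun d => (d 0, d 1))
    fun d hd => idx_mono hp (degree_pair_mem_idx hd), ← Finset.sum_coe_sort (idx k)]
  refine Finset.sum_congr rfl fun α _ => ?_
  rw [Finset.sum_mul]
  refine Finset.sum_congr rfl fun d hd => ?_
  rw [← (Finset.mem_filter.1 hd).2]

/-- Lagrange interpolation with affine factors: `L b` is the inner product of `a - b` with `x - b`,
so it vanishes at `b` and equals the squared distance at `a`. -/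
theorem exists_interpolation {A : Finset (ℝ × ℝ)} {k : ℕ} (hk : A.card ≤ k) {a : ℝ × ℝ}
    (ha : a ∈ A) : ∃ c : idx k → ℝ, ∀ b ∈ A,
      ∑ α, c α * (b.1 ^ α.1.1 * b.2 ^ α.1.2) = if b = a then 1 else 0 := by
  let L : ℝ × ℝ → Poly := fun b =>
    MvPolynomial.C (a.1 - b.1) * (MvPolynomial.X 0 - MvPolynomial.C b.1) +
      MvPolynomial.C (a.2 - b.2) * (MvPolynomial.X 1 - MvPolynomial.C b.2)
  have hLdeg : ∀ b, (L b).totalDegree ≤ 1 := by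
    intro b
    refine (MvPolynomial.totalDegree_add _ _).trans (max_le ?_ ?_) <;>
    · refine (MvPolynomial.totalDegree_mul _ _).trans ?_
      rw [MvPolynomial.totalDegree_C, zero_add]
      refine (MvPolynomial.totalDegree_sub_C_le _ _).trans ?_
      rw [MvPolynomial.totalDegree_X]
  have hLa : ∀ b x, evalAt (L b) x = (a.1 - b.1) * (x.1 - b.1) + (a.2 - b.2) * (x.2 - b.2) := by
    intro b x; simp [evalAt, L]
  have hLne : ∀ b, b ≠ a → evalAt (L b) a ≠ 0 := by
    intro b hb h
    rw [hLa] at h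
    have h1 : a.1 - b.1 = 0 := by nlinarith [sq_nonneg (a.1 - b.1), sq_nonneg (a.2 - b.2)]
    have h2 : a.2 - b.2 = 0 := by nlinarith [sq_nonneg (a.1 - b.1), sq_nonneg (a.2 - b.2)]
    exact hb (Prod.ext (by linarith) (by linarith))
  let P : Poly := ∏ b ∈ A.erase a, MvPolynomial.C (evalAt (L b) a)⁻¹ * L b
  have hP : ∀ x, evalAt P x = ∏ b ∈ A.erase a, (evalAt (L b) a)⁻¹ * evalAt (L b) x := by
    intro x; simp [P, evalAt, map_prod]
  have hdeg : P.totalDegree ≤ k := by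
    refine (MvPolynomial.totalDegree_finsetProd _ _).trans ?_
    refine (Finset.sum_le_card_nsmul _ _ 1 fun b _ => ?_).trans ?_
    · refine (MvPolynomial.totalDegree_mul _ _).trans ?_
      rw [MvPolynomial.totalDegree_C, zero_add]
      exact hLdeg b
    · rw [smul_eq_mul, mul_one]
      exact (Finset.card_erase_le).trans hk
  obtain ⟨c, hc⟩ := exists_coeffs_of_totalDegree_le hdeg
  refine ⟨c, fun b hb => ?_⟩
  rw [hc, hP]
  split_ifs with hba
  · subst hba
    exact Finset.prod_eq_one fun b' hb' => inv_mul_cancel₀ (hLne b' (Finset.ne_of_mem_erase hb'))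
  · refine Finset.prod_eq_zero (Finset.mem_erase.2 ⟨hba, hb⟩) ?_
    rw [hLa b b]
    simp

/-- The matrix factors as `Cᵀ C` with `C` a Vandermonde matrix scaled by square roots of the
weights; interpolation makes its rows independent. -/
theorem rank_momentMatrix_atomic {A : Finset (ℝ × ℝ)} {w : ℝ × ℝ → ℝ} (hw : ∀ a ∈ A, 0 < w a)
    {k : ℕ} (hk : A.card ≤ k) {y : ℕ × ℕ → ℝ}
    (hy : ∀ γ ∈ idx (k + k), y γ = ∑ a ∈ A, w a * (a.1 ^ γ.1 * a.2 ^ γ.2)) :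
    (momentMatrix k y).rank = A.card := by
  let C : Matrix A (idx k) ℝ := Matrix.of fun a α =>
    Real.sqrt (w a) * (a.1.1 ^ α.1.1 * a.1.2 ^ α.1.2)
  have hC : momentMatrix k y = C.transpose * C := by
    ext α β
    rw [Matrix.mul_apply, momentMatrix, Matrix.of_apply, hy _ (add_mem_idx α.2 β.2),
      ← Finset.sum_coe_sort A]
    refine Finset.sum_congr rfl fun a _ => ?_
    simp only [Matrix.transpose_apply, C, Matrix.of_apply, Prod.fst_add, Prod.snd_add]
    nth_rewrite 1 [← Real.mul_self_sqrt (hw a a.2).le]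
    ring
  rw [hC, Matrix.rank_transpose_mul_self]
  have hli : LinearIndependent ℝ C.row := by
    rw [Fintype.linearIndependent_iff]
    intro g hg a
    obtain ⟨c, hc⟩ := exists_interpolation hk a.2
    have h1 : ∀ α : idx k, ∑ b : A, g b * (Real.sqrt (w b) * (b.1.1 ^ α.1.1 * b.1.2 ^ α.1.2)) = 0 := by
      intro α
      simpa [C] using congrFun hg α
    have h2 : ∑ α, c α * ∑ b : A, g b * (Real.sqrt (w b) * (b.1.1 ^ α.1.1 * b.1.2 ^ α.1.2)) = 0 :=
      Finset.sum_eq_zero fun α _ => by rw [h1, mul_zero]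
    have h3 : ∑ α, c α * ∑ b : A, g b * (Real.sqrt (w b) * (b.1.1 ^ α.1.1 * b.1.2 ^ α.1.2)) =
        ∑ b : A, g b * Real.sqrt (w b) * ∑ α, c α * (b.1.1 ^ α.1.1 * b.1.2 ^ α.1.2) := by
      simp_rw [Finset.mul_sum]
      rw [Finset.sum_comm]
      refine Finset.sum_congr rfl fun b _ => Finset.sum_congr rfl fun α _ => ?_
      ring
    rw [h3, Finset.sum_eq_single a] at h2
    · rw [hc _ a.2, if_pos rfl, mul_one] at h2
      exact (mul_eq_zero.1 h2).resolve_right (Real.sqrt_pos.2 (hw a a.2)).ne'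
    · intro b _ hba
      rw [hc _ b.2, if_neg fun h => hba (Subtype.ext h), mul_zero]
    · simp
  rw [hli.rank_matrix, Fintype.card_coe]

theorem integral_atomic (A : Finset (ℝ × ℝ)) (w : ℝ × ℝ → ℝ≥0) (f : ℝ × ℝ → ℝ) :
    ∫ a, f a ∂(∑ a ∈ A, w a • Measure.dirac a) = ∑ a ∈ A, (w a : ℝ) * f a := by
  rw [integral_finsetSum_measure]
  · refine Finset.sum_congr rfl fun a _ => ?_
    rw [integral_smul_nnreal_measure, integral_dirac]
    rfl
  · intro a _
    exact (integrable_dirac (by simp)).smul_measure_nnreal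

theorem integrable_atomic (A : Finset (ℝ × ℝ)) (w : ℝ × ℝ → ℝ≥0) (f : ℝ × ℝ → ℝ) :
    Integrable f (∑ a ∈ A, w a • Measure.dirac a) :=
  integrable_finsetSum_measure.2 fun _ _ => (integrable_dirac (by simp)).smul_measure_nnreal

/-! ### The parameter set -/

section ParameterSet

variable {s : ℕ} {u : Fin s → Poly} {R : ℝ}

theorem evalAt_ball (a : ℝ × ℝ) :
    evalAt (MvPolynomial.C (R ^ 2) - MvPolynomial.X 0 ^ 2 - MvPolynomial.X 1 ^ 2) a =
      R ^ 2 - a.1 ^ 2 - a.2 ^ 2 := by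
  simp [evalAt]

theorem sq_add_sq_le_of_mem_semialgSet
    (hball : ∃ j, u j = MvPolynomial.C (R ^ 2) - MvPolynomial.X 0 ^ 2 - MvPolynomial.X 1 ^ 2)
    {a : ℝ × ℝ} (ha : a ∈ semialgSet u) : a.1 ^ 2 + a.2 ^ 2 ≤ R ^ 2 := by
  obtain ⟨j, hj⟩ := hball
  have := ha j
  rw [hj, evalAt_ball] at this
  linarith

theorem halfDeg_le_maxHalfDeg (j : Fin s) : halfDeg (u j) ≤ maxHalfDeg u :=
  Finset.le_sup (f := fun j => halfDeg (u j)) (Finset.mem_univ j)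

/-- The ball polynomial takes different values at `(0, 0)` and `(1, 0)`, so it is not constant.
Hence every admissible order is at least 1, the flatness gap is positive, and the quadratic cost
uses genuine entries. -/
theorem one_le_maxHalfDeg
    (hball : ∃ j, u j = MvPolynomial.C (R ^ 2) - MvPolynomial.X 0 ^ 2 - MvPolynomial.X 1 ^ 2) :
    1 ≤ maxHalfDeg u := by
  obtain ⟨j, hj⟩ := hball
  refine le_trans ?_ (halfDeg_le_maxHalfDeg j)
  by_contra h
  have h0 : (u j).totalDegree = 0 := by unfold halfDeg at h; omega
  rw [MvPolynomial.totalDegree_eq_zero_iff_eq_C] at h0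
  have h1 := evalAt_ball (R := R) (0, 0)
  have h2 := evalAt_ball (R := R) (1, 0)
  rw [← hj, h0] at h1 h2
  simp only [evalAt, MvPolynomial.eval_C] at h1 h2
  rw [h1] at h2
  linarith

theorem GaussMix.IsProbOn.ae_mem {S : Set (ℝ × ℝ)} {φ : Measure (ℝ × ℝ)} (h : IsProbOn S φ) :
    ∀ᵐ a ∂φ, a ∈ S := h.carried

theorem integrable_monomial_of_ae_bounded {φ : Measure (ℝ × ℝ)} [IsProbabilityMeasure φ]
    (hφ : ∀ᵐ a ∂φ, a.1 ^ 2 + a.2 ^ 2 ≤ R ^ 2) (γ : ℕ × ℕ) :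
    Integrable (fun a : ℝ × ℝ => a.1 ^ γ.1 * a.2 ^ γ.2) φ := by
  refine Integrable.of_bound (by fun_prop) (|R| ^ γ.1 * |R| ^ γ.2) ?_
  filter_upwards [hφ] with a ha
  rw [Real.norm_eq_abs, abs_mul, abs_pow, abs_pow]
  have h1 : |a.1| ≤ |R| := sq_le_sq.1 (by nlinarith [sq_nonneg a.2])
  have h2 : |a.2| ≤ |R| := sq_le_sq.1 (by nlinarith [sq_nonneg a.1])
  gcongr

end ParameterSet

/-! ### The diagonal coupling -/

section Diagonal

variable {μ : Measure ℝ}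

theorem integral_diagCoupling {f : ℝ × ℝ → ℝ} (hf : Continuous f) :
    ∫ p, f p ∂diagCoupling μ = ∫ x, f (x, x) ∂μ :=
  integral_map (by fun_prop) hf.aestronglyMeasurable

theorem integrable_monomial_diagCoupling (hμ : ∀ j : ℕ, Integrable (fun x : ℝ => x ^ j) μ)
    (γ : ℕ × ℕ) : Integrable (fun a : ℝ × ℝ => a.1 ^ γ.1 * a.2 ^ γ.2) (diagCoupling μ) := by
  unfold diagCoupling
  rw [integrable_map_measure (by fun_prop) (by fun_prop)]
  refine (hμ (γ.1 + γ.2)).congr (Filter.Eventually.of_forall fun x => ?_)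
  simp [pow_add]

theorem otCost_diagCoupling : otCost (diagCoupling μ) = 0 := by
  unfold otCost diagCoupling
  rw [lintegral_map (by fun_prop) (by fun_prop)]
  simp

theorem otFeasible_diagCoupling [IsProbabilityMeasure μ] {S : Set (ℝ × ℝ)}
    {φ : Measure (ℝ × ℝ)} (hφ : IsProbOn S φ) (h : μ = mixture φ) :
    OTFeasible μ S (diagCoupling μ) φ where
  mixing := hφ
  prob := Measure.isProbabilityMeasure_map (by fun_prop)
  fst := by
    rw [diagCoupling, Measure.map_map measurable_fst (by fun_prop)]
    exact Measure.map_id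
  snd := by
    rw [← h, diagCoupling, Measure.map_map measurable_snd (by fun_prop)]
    exact Measure.map_id

theorem otValue_eq_zero [IsProbabilityMeasure μ] {S : Set (ℝ × ℝ)}
    {φ : Measure (ℝ × ℝ)} (hφ : IsProbOn S φ) (h : μ = mixture φ) : otValue μ S = 0 := by
  refine le_antisymm ?_ bot_le
  rw [← otCost_diagCoupling (μ := μ)]
  exact iInf_le_of_le _ (iInf_le_of_le φ (iInf_le _ (otFeasible_diagCoupling hφ h)))

theorem isGaussianMixture_iff_exists_otOptimal [IsProbabilityMeasure μ] (S : Set (ℝ × ℝ)) :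
    IsGaussianMixture S μ ↔ ∃ φ, OTOptimal μ S (diagCoupling μ) φ := by
  constructor
  · rintro ⟨φ, hφ, h⟩
    exact ⟨φ, otFeasible_diagCoupling hφ h, by rw [otCost_diagCoupling, otValue_eq_zero hφ h]⟩
  · rintro ⟨φ, hφ, -⟩
    refine ⟨φ, hφ.mixing, ?_⟩
    rw [← hφ.snd, diagCoupling, Measure.map_map measurable_snd (by fun_prop)]
    exact Measure.map_id.symm

end Diagonal

/-! ### The semidefinite relaxations -/

section Relaxation

variable {μ : Measure ℝ} {s : ℕ} {u : Fin s → Poly} {n : ℕ}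

/-- The vector `c` is the coefficient vector of `x - y`. -/
theorem quadForm_diff {y : ℕ × ℕ → ℝ} (hn : 1 ≤ n) :
    ∃ c : idx n → ℝ,
      (∀ α : idx n, (momentMatrix n y).mulVec c α = y (α.1 + (1, 0)) - y (α.1 + (0, 1))) ∧
      c ⬝ᵥ (momentMatrix n y).mulVec c = y (2, 0) - 2 * y (1, 1) + y (0, 2) := by
  classical
  have h10 : ((1, 0) : ℕ × ℕ) ∈ idx n := by simpa [mem_idx] using hn
  have h01 : ((0, 1) : ℕ × ℕ) ∈ idx n := by simpa [mem_idx] using hn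
  have h : ∀ α : idx n, (momentMatrix n y).mulVec
      (Pi.single ⟨(1, 0), h10⟩ 1 - Pi.single ⟨(0, 1), h01⟩ 1) α =
        y (α.1 + (1, 0)) - y (α.1 + (0, 1)) := by
    intro α
    simp [Matrix.mulVec_sub, momentMatrix]
  refine ⟨_, h, ?_⟩
  rw [sub_dotProduct, single_one_dotProduct, single_one_dotProduct, h, h]
  simp
  ring

theorem relaxCost_nonneg (hn : 1 ≤ n) {lam : idx (2 * n) → ℝ}
    (hpsd : (momentMatrix n (extend lam)).PosSemidef) : 0 ≤ relaxCost lam := by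
  obtain ⟨c, -, hc⟩ := quadForm_diff (y := extend lam) hn
  rw [relaxCost_eq, ← hc]
  simpa using hpsd.dotProduct_mulVec_nonneg c

/-- A vector on which a positive semidefinite form vanishes lies in the kernel. So `lam` annihilates
`(x - y)` times any monomial of degree at most `n`, and in degree up to `n + 1` each `x` can be
traded for a `y`, one at a time. -/
theorem moments_eq_of_relaxCost_eq_zero (hn : 1 ≤ n) {lam : idx (2 * n) → ℝ}
    (hpsd : (momentMatrix n (extend lam)).PosSemidef) (h0 : relaxCost lam = 0) {j : ℕ}
    (hj : j ≤ n + 1) : extend lam (j, 0) = extend lam (0, j) := by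
  obtain ⟨c, hc, hcc⟩ := quadForm_diff (y := extend lam) hn
  rw [← relaxCost_eq, h0] at hcc
  have hker := (hpsd.dotProduct_mulVec_zero_iff c).1 (by rwa [star_trivial])
  have hstep : ∀ a b, a + b ≤ n → extend lam (a + 1, b) = extend lam (a, b + 1) := by
    intro a b hab
    have h1 := hc ⟨(a, b), mem_idx.2 hab⟩
    rw [hker] at h1
    simp only [Pi.zero_apply, Prod.mk_add_mk, add_zero] at h1
    linarith
  have : ∀ i ≤ j, extend lam (j, 0) = extend lam (j - i, i) := by
    intro i
    induction i with
    | zero => intro _; rfl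
    | succ i ih =>
      intro hi
      rw [ih (by omega), show j - i = j - (i + 1) + 1 by omega]
      exact hstep _ _ (by omega)
  simpa using this j le_rfl

theorem relaxFeasible_momentVec {R : ℝ}
    (hball : ∃ j, u j = MvPolynomial.C (R ^ 2) - MvPolynomial.X 0 ^ 2 - MvPolynomial.X 1 ^ 2)
    (hμ : ∀ j : ℕ, Integrable (fun x : ℝ => x ^ j) μ) (hn : maxHalfDeg u ≤ n)
    {φ : Measure (ℝ × ℝ)} (hφ : IsProbOn (semialgSet u) φ) (h : μ = mixture φ) :
    RelaxFeasible μ u n (momentVec (2 * n) (diagCoupling μ)) (momentVec (2 * n) φ) := by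
  have := hφ.prob
  have hb : ∀ᵐ a ∂φ, a.1 ^ 2 + a.2 ^ 2 ≤ R ^ 2 := by
    filter_upwards [hφ.ae_mem] with a ha using sq_add_sq_le_of_mem_semialgSet hball ha
  have hintφ := integrable_monomial_of_ae_bounded hb
  have hintd := integrable_monomial_diagCoupling hμ
  have hyφ : ∀ γ ∈ idx (2 * n), extend (momentVec (2 * n) φ) γ =
      ∫ a, a.1 ^ γ.1 * a.2 ^ γ.2 ∂φ := fun γ hγ => extend_momentVec hγ
  have hyd : ∀ γ ∈ idx (2 * n), extend (momentVec (2 * n) (diagCoupling μ)) γ =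
      ∫ a, a.1 ^ γ.1 * a.2 ^ γ.2 ∂diagCoupling μ := fun γ hγ => extend_momentVec hγ
  refine ⟨fun j hj => ?_, fun j hj => ?_, ?_, ?_, fun j => ?_⟩
  · rw [hyd _ (by simpa [mem_idx] using hj), integral_diagCoupling (by fun_prop)]
    simp
  · rw [hyd _ (by simpa [mem_idx] using hj), integral_diagCoupling (by fun_prop),
      riesz_eq_integral hintφ hyφ ((totalDegree_gaussMoment_le j).trans hj),
      ← integral_pow_mixture hb, ← h]
    simp
  · refine posSemidef_momentMatrix (ν := diagCoupling μ) (f := fun _ => 1) (by simp)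
      (fun γ => by simpa using hintd γ) fun γ hγ => ?_
    simpa using hyd γ (by rwa [two_mul])
  · refine posSemidef_momentMatrix (ν := φ) (f := fun _ => 1) (by simp)
      (fun γ => by simpa using hintφ γ) fun γ hγ => ?_
    simpa using hyφ γ (by rwa [two_mul])
  · refine posSemidef_momentMatrix (ν := φ) (f := evalAt (u j)) ?_
      (integrable_evalAt_mul hintφ (u j)) fun γ hγ => ?_
    · filter_upwards [hφ.ae_mem] with a ha using ha j
    -- The degree count is `2 (n - d_j) + deg u_j ≤ 2 n`, from `deg u_j ≤ 2 d_j` and `d_j ≤ n`.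
    · refine shift_eq_integral hintφ hyφ ?_ hγ
      have h1 := (halfDeg_le_maxHalfDeg (u := u) j).trans hn
      unfold halfDeg at h1 ⊢
      omega

theorem relaxCost_momentVec_diagCoupling (hμ : ∀ j : ℕ, Integrable (fun x : ℝ => x ^ j) μ)
    (hn : 1 ≤ n) : relaxCost (momentVec (2 * n) (diagCoupling μ)) = 0 := by
  have hdeg : ((MvPolynomial.X 0 - MvPolynomial.X 1) ^ 2 : Poly).totalDegree ≤ 2 * n := by
    refine (MvPolynomial.totalDegree_pow _ _).trans (Nat.mul_le_mul le_rfl ?_ |>.trans_eq rfl)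
    refine (MvPolynomial.totalDegree_sub _ _).trans ?_
    simpa using hn
  rw [relaxCost, riesz_eq_integral (integrable_monomial_diagCoupling hμ)
    (fun γ hγ => extend_momentVec hγ) hdeg, integral_diagCoupling (continuous_evalAt _)]
  simp [evalAt]

theorem relaxValue_eq_zero {lam phi : idx (2 * n) → ℝ} (hn : 1 ≤ n)
    (hf : RelaxFeasible μ u n lam phi) (h0 : relaxCost lam = 0) : relaxValue μ u n = 0 := by
  apply le_antisymm
  · refine iInf_le_of_le lam (iInf_le_of_le phi (iInf_le_of_le hf ?_))
    rw [h0]; rfl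
  · refine le_iInf fun lam' => le_iInf fun phi' => le_iInf fun hf' => ?_
    exact EReal.coe_nonneg.2 (relaxCost_nonneg hn hf'.psd_lam)

/-- A flat feasible point of the relaxation comes from an atomic measure on the parameter set. -/
theorem exists_atomic_of_isFlat [IsProbabilityMeasure μ] {R : ℝ}
    (hball : ∃ j, u j = MvPolynomial.C (R ^ 2) - MvPolynomial.X 0 ^ 2 - MvPolynomial.X 1 ^ 2)
    (hn : maxHalfDeg u ≤ n) {r : ℕ} {lam phi : idx (2 * n) → ℝ}
    (hf : RelaxFeasible μ u n lam phi) (hflat : IsFlat u n r phi) :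
    ∃ φ : Measure (ℝ × ℝ), IsProbOn (semialgSet u) φ ∧ IsAtomic r φ ∧
      phi = momentVec (2 * n) φ := by
  have h1 := one_le_maxHalfDeg hball
  obtain ⟨A, w, hcard, hw, hy, hinterp⟩ := flat_extension hf.psd_phi
    (k := n - maxHalfDeg u) (by omega) hflat.1 hflat.2
  let w' : ℝ × ℝ → ℝ≥0 := fun a => (w a).toNNReal
  have hw' : ∀ a ∈ A, (w' a : ℝ) = w a := fun a ha => Real.coe_toNNReal _ (hw a ha).le
  let φ : Measure (ℝ × ℝ) := ∑ a ∈ A, w' a • Measure.dirac a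
  have hI : ∀ f : ℝ × ℝ → ℝ, ∫ a, f a ∂φ = ∑ a ∈ A, w a * f a := fun f => by
    rw [integral_atomic]
    exact Finset.sum_congr rfl fun a ha => by rw [hw' a ha]
  have hint : ∀ f : ℝ × ℝ → ℝ, Integrable f φ := integrable_atomic A w'
  have hyφ : ∀ γ ∈ idx (2 * n), extend phi γ = ∫ a, a.1 ^ γ.1 * a.2 ^ γ.2 ∂φ := fun γ hγ => by
    rw [hy γ hγ, hI]
  have hmem : ∀ a ∈ A, a ∈ semialgSet u := by
    intro a ha j
    -- The interpolation polynomial at `a` has degree at most `n - v ≤ n - d_j`, so the localizing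
    -- matrix can be tested on it. Only the atom `a` survives, giving `w a * u_j(a) ≥ 0`.
    obtain ⟨c, hc⟩ := hinterp a ha
    have hle : n - maxHalfDeg u ≤ n - halfDeg (u j) :=
      Nat.sub_le_sub_left (halfDeg_le_maxHalfDeg j) n
    have hpsd : (momentMatrix (n - maxHalfDeg u) (shift (u j) (extend phi))).PosSemidef :=
      (hf.psd_loc j).submatrix fun α : idx (n - maxHalfDeg u) =>
        (⟨α, idx_mono hle α.2⟩ : idx (n - halfDeg (u j)))
    have hq := hpsd.dotProduct_mulVec_nonneg c
    rw [star_trivial, quadForm_momentMatrix (ν := φ) (f := evalAt (u j)) (fun γ => hint _)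
      (fun γ hγ => shift_eq_integral (fun γ => hint _) hyφ ?_ hγ), hI, Finset.sum_eq_single a,
      hc a ha, if_pos rfl, one_pow, mul_one] at hq
    · exact nonneg_of_mul_nonneg_right hq (hw a ha)
    · intro b hb hba
      rw [hc b hb, if_neg hba]; simp
    · exact fun h => (h ha).elim
    · have h2 := halfDeg_le_maxHalfDeg (u := u) j
      unfold halfDeg at h2
      omega
  refine ⟨φ, ⟨⟨?_⟩, ?_⟩, ⟨A, w', hcard, fun a ha => Real.toNNReal_pos.2 (hw a ha), rfl⟩, ?_⟩
  -- Total mass: the two linear constraints in degree 0 identify it with the mass of `μ`.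
  · have h2 := hf.fst 0 (by omega)
    have h3 := hf.snd 0 (by omega)
    rw [riesz_eq_integral (fun γ => hint _) hyφ ((totalDegree_gaussMoment_le 0).trans (by omega)),
      h2] at h3
    simp only [evalAt_gaussMoment] at h3
    simp [sub_eq_zero] at h3
    rw [Measure.real, eq_comm, ENNReal.toReal_eq_one_iff] at h3
    exact h3
  · simp only [φ, Measure.coe_finsetSum, Finset.sum_apply, Measure.smul_apply]
    refine Finset.sum_eq_zero fun a ha => ?_
    simp [hmem a ha]
  · funext α
    have := hyφ α α.2
    rwa [GaussMix.extend, dif_pos α.2] at this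

/-- From order `v + r` on, even the smaller matrix has order at least `r`, enough to interpolate at
`r` points. -/
theorem isFlat_momentVec {r : ℕ} {φ : Measure (ℝ × ℝ)} (hφ : IsAtomic r φ)
    (hn : maxHalfDeg u + r ≤ n) : IsFlat u n r (momentVec (2 * n) φ) := by
  obtain ⟨A, w, rfl, hw, rfl⟩ := hφ
  have h : ∀ γ ∈ idx (2 * n), extend (momentVec (2 * n) (∑ a ∈ A, w a • Measure.dirac a)) γ =
      ∑ a ∈ A, (w a : ℝ) * (a.1 ^ γ.1 * a.2 ^ γ.2) := fun γ hγ => by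
    rw [extend_momentVec hγ, integral_atomic]
  exact ⟨rank_momentMatrix_atomic (w := fun a => w a) hw (by omega)
      fun γ hγ => h γ (idx_mono (by omega) hγ),
    rank_momentMatrix_atomic (w := fun a => w a) hw (by omega)
      fun γ hγ => h γ (idx_mono (by omega) hγ)⟩

/-- If the relaxation has value zero at the moments of `φ`, then `μ` and the mixture `ν_φ` agree
as soon as their moments of degree more than `n + 1` do. -/
theorem eq_mixture_iff [IsProbabilityMeasure μ] {R : ℝ}
    (hball : ∃ j, u j = MvPolynomial.C (R ^ 2) - MvPolynomial.X 0 ^ 2 - MvPolynomial.X 1 ^ 2)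
    (hμ : ∀ j : ℕ, Integrable (fun x : ℝ => x ^ j) μ) (hn : 1 ≤ n)
    {φ : Measure (ℝ × ℝ)} (hφ : IsProbOn (semialgSet u) φ) {lam : idx (2 * n) → ℝ}
    (hf : RelaxFeasible μ u n lam (momentVec (2 * n) φ)) (h0 : relaxCost lam = 0) :
    μ = mixture φ ↔ ∀ j, n + 1 < j → ∫ x, x ^ j ∂μ = ∫ a, evalAt (gaussMoment j) a ∂φ := by
  have := hφ.prob
  have := isProbabilityMeasure_mixture φ
  have hb : ∀ᵐ a ∂φ, a.1 ^ 2 + a.2 ^ 2 ≤ R ^ 2 := by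
    filter_upwards [hφ.ae_mem] with a ha using sq_add_sq_le_of_mem_semialgSet hball ha
  constructor
  · intro h j _
    rw [h, integral_pow_mixture hb]
  · intro h
    refine measure_ext_of_moments hμ (integrable_exp_mixture hb) fun j => ?_
    rw [integral_pow_mixture hb]
    -- Moments of degree at most `n + 1` agree because the cost is zero; `n + 1 ≤ 2 * n` keeps them
    -- within the constraints of the relaxation.
    rcases lt_or_ge (n + 1) j with hj | hj
    · exact h j hj
    · have hj2 : j ≤ 2 * n := by omega
      rw [← hf.fst j hj2, moments_eq_of_relaxCost_eq_zero hn hf.psd_lam h0 hj,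
        sub_eq_zero.1 (hf.snd j hj2)]
      exact riesz_eq_integral (integrable_monomial_of_ae_bounded hb)
        (fun γ hγ => extend_momentVec hγ) ((totalDegree_gaussMoment_le j).trans hj2)

end Relaxation

theorem theorem3p8 (μ : Measure ℝ) [IsProbabilityMeasure μ]
    (hμ : ∀ j : ℕ, Integrable (fun x : ℝ => x ^ j) μ)
    {s : ℕ} (u : Fin s → Poly) (R : ℝ)
    (hball : ∃ j, u j =
      MvPolynomial.C (R ^ 2) - MvPolynomial.X 0 ^ 2 - MvPolynomial.X 1 ^ 2)
    (hσ : ∀ a ∈ semialgSet u, 0 ≤ a.2) :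
    (IsGaussianMixture (semialgSet u) μ ↔
      ∃ φ : Measure (ℝ × ℝ), OTOptimal μ (semialgSet u) (diagCoupling μ) φ) ∧
    (IsGaussianMixture (semialgSet u) μ →
      otValue μ (semialgSet u) = 0 ∧ ∀ n, maxHalfDeg u ≤ n → relaxValue μ u n = 0) ∧
    (∀ (r : ℕ) (φ : Measure (ℝ × ℝ)), IsProbOn (semialgSet u) φ → IsAtomic r φ →
      μ = mixture φ → ∃ N, maxHalfDeg u ≤ N ∧ ∀ n, N ≤ n →
        RelaxOptimal μ u n (momentVec (2 * n) (diagCoupling μ)) (momentVec (2 * n) φ) ∧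
        IsFlat u n r (momentVec (2 * n) φ)) ∧
    (∀ (n r : ℕ) (lam phi : idx (2 * n) → ℝ), maxHalfDeg u ≤ n →
      RelaxOptimal μ u n lam phi → relaxValue μ u n = 0 → IsFlat u n r phi →
      (∃ φ : Measure (ℝ × ℝ), IsProbOn (semialgSet u) φ ∧ IsAtomic r φ ∧
        phi = momentVec (2 * n) φ) ∧
      (∀ φ : Measure (ℝ × ℝ), IsProbOn (semialgSet u) φ → IsAtomic r φ →
        phi = momentVec (2 * n) φ →
        (μ = mixture φ ↔
          ∀ j, n + 1 < j → ∫ x, x ^ j ∂μ = ∫ a, evalAt (gaussMoment j) a ∂φ))) := by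
  have hv := one_le_maxHalfDeg hball
  refine ⟨isGaussianMixture_iff_exists_otOptimal _, ?_, ?_, ?_⟩
  · rintro ⟨φ, hφ, h⟩
    exact ⟨otValue_eq_zero hφ h, fun n hn => relaxValue_eq_zero (hv.trans hn)
      (relaxFeasible_momentVec hball hμ hn hφ h)
      (relaxCost_momentVec_diagCoupling hμ (hv.trans hn))⟩
  · intro r φ hφ hr h
    refine ⟨maxHalfDeg u + r, Nat.le_add_right _ _, fun n hn => ⟨?_, isFlat_momentVec hr hn⟩⟩
    have hn' : maxHalfDeg u ≤ n := le_trans (Nat.le_add_right _ _) hn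
    have hf := relaxFeasible_momentVec hball hμ hn' hφ h
    have h0 := relaxCost_momentVec_diagCoupling hμ (hv.trans hn')
    refine ⟨hf, ?_⟩
    rw [relaxValue_eq_zero (hv.trans hn') hf h0, h0]
    rfl
  · intro n r lam phi hn hopt hval hflat
    refine ⟨exists_atomic_of_isFlat hball hn hopt.1 hflat, ?_⟩
    rintro φ hφ - rfl
    have h0 : relaxCost lam = 0 := by
      have := hopt.2
      rw [hval] at this
      exact_mod_cast this
    exact eq_mixture_iff hball hμ (hv.trans hn) hφ hopt.1 h0
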